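/- Theorem 3.9. Let $K$ be an algebraically closed field and let $s\ge 3$ be an integer. Let $\Gamma_s$ be the circular quiver with double arrows: its vertices are $0,1,\dots,s-1$, taken modulo $s$, and for each vertex $i$ there are exactly two arrows $a_i,b_i\colon i\to i+1$. In the path algebra $K\Gamma_s$ (paths being composed from left to right) put $x=\sum_{i=0}^{s-1}a_i$ and $y=\sum_{i=0}^{s-1}b_i$, and let $\Lambda_s=K\Gamma_s/\langle x^2,\;xy+yx,\;y^2\rangle$. For $n\ge 0$ let $$\mathrm{HH}^n(\Lambda_s)=\mathrm{Ext}^n_{\Lambda_s^e}(\Lambda_s,\Lambda_s)$$ be the $n$-th Hochschild cohomology group of $\Lambda_s$, where $\Lambda_s^e=\Lambda_s^{\mathrm{op}}\otimes_K\Lambda_s$ is the enveloping algebra. Let $n=ms+r$ with integers $m\ge 0$ and $0\le r\le s-1$. Then $\mathrm{HH}^n(\Lambda_s)$ is finite-dimensional over $K$, and $$\dim_K \mathrm{HH}^{ms+r}(\Lambda_s)=\begin{cases} ms+1 & \text{if } r=0 \text{ and } (s \text{ is even, or } m \text{ is even, or } \operatorname{char}K=2),\\ 2ms+4 & \text{if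 } r=1 \text{ and } (s \text{ is even, or } m \text{ is even, or } \operatorname{char}K=2),\\ ms+3 & \text{if } r=2 \text{ and } (s \text{ is even, or } m \text{ is even, or } \operatorname{char}K=2),\\ 0 & \text{otherwise.}\end{cases}$$ -/

import Mathlib

universe u v w

noncomputable section

open CategoryTheory MulOpposite
open scoped TensorProduct

/-! ### Path algebras -/

/-- The type of all paths of a quiver: a path together with its origin and its terminus. -/
abbrev QuiverPaths (V : Type v) [Quiver.{w} V] : Type (max v w) :=
  Σ a b : V, Quiver.Path a b

/-- The path algebra `K Q` of a quiver `Q` with vertex set `V`: the vector space over `K` with the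
paths of `Q` (trivial ones included) as a basis. -/
def PathAlgebra (K : Type u) [Field K] (V : Type v) [Quiver.{w} V] : Type (max u v w) :=
  QuiverPaths V →₀ K

namespace PathAlgebra

variable {K : Type u} [Field K] {V : Type v} [Quiver.{w} V]

instance : AddCommGroup (PathAlgebra K V) :=
  inferInstanceAs (AddCommGroup (QuiverPaths V →₀ K))

instance : Module K (PathAlgebra K V) :=
  inferInstanceAs (Module K (QuiverPaths V →₀ K))

/-- The basis of the path algebra given by the paths. -/
def basis (K : Type u) [Field K] (V : Type v) [Quiver.{w} V] :
    Module.Basis (QuiverPaths V) K (PathAlgebra K V) :=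
  ⟨LinearEquiv.refl K (QuiverPaths V →₀ K)⟩

/-- A path, regarded as an element of the path algebra. -/
def ofPath (K : Type u) [Field K] {V : Type v} [Quiver.{w} V] {a b : V} (p : Quiver.Path a b) :
    PathAlgebra K V :=
  basis K V ⟨a, b, p⟩

open Classical in
/-- The product of two paths: the path `p` followed by the path `q` if `p` ends where `q` starts,
and zero otherwise. -/
def pathMul (K : Type u) [Field K] {V : Type v} [Quiver.{w} V] (p q : QuiverPaths V) :
    PathAlgebra K V :=
  if h : p.2.1 = q.1 then ofPath K (p.2.2.comp (q.2.2.cast h.symm rfl)) else 0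

/-- The multiplication of the path algebra: the bilinear extension of the product of paths. -/
def mulHom : PathAlgebra K V →ₗ[K] PathAlgebra K V →ₗ[K] PathAlgebra K V :=
  (basis K V).constr K fun p => (basis K V).constr K fun q => pathMul K p q

instance : Mul (PathAlgebra K V) := ⟨fun f g => mulHom f g⟩

/-- The unit of the path algebra of a quiver with finitely many vertices: the sum of the trivial
paths. -/
instance [Fintype V] : One (PathAlgebra K V) :=
  ⟨∑ a : V, ofPath K (Quiver.Path.nil : Quiver.Path a a)⟩

theorem mul_def (f g : PathAlgebra K V) : f * g = mulHom f g := rfl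

theorem one_def [Fintype V] :
    (1 : PathAlgebra K V) = ∑ a : V, ofPath K (Quiver.Path.nil : Quiver.Path a a) := rfl

theorem basis_mul_basis (p q : QuiverPaths V) :
    basis K V p * basis K V q = pathMul K p q := by
  simp [mul_def, mulHom]

theorem ofPath_mul_ofPath {a b c : V} (p : Quiver.Path a b) (q : Quiver.Path b c) :
    ofPath K p * ofPath K q = ofPath K (p.comp q) := by
  simp [ofPath, basis_mul_basis, pathMul]

theorem ofPath_mul_ofPath_of_ne {a b c d : V} (p : Quiver.Path a b) (q : Quiver.Path c d)
    (h : b ≠ c) : ofPath K p * ofPath K q = 0 := by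
  simp [ofPath, basis_mul_basis, pathMul, h]

@[elab_as_elim]
theorem induction_on {P : PathAlgebra K V → Prop} (f : PathAlgebra K V) (zero : P 0)
    (add : ∀ f g, P f → P g → P (f + g))
    (smul : ∀ (c : K) {a b : V} (p : Quiver.Path a b), P (c • ofPath K p)) : P f := by
  rw [← (basis K V).linearCombination_repr f, Finsupp.linearCombination_apply]
  exact Finset.sum_induction _ P add zero fun p _ => smul _ p.2.2

protected theorem add_mul' (f g h : PathAlgebra K V) : (f + g) * h = f * h + g * h := by
  simp [mul_def]

protected theorem mul_add' (f g h : PathAlgebra K V) : f * (g + h) = f * g + f * h := by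
  simp [mul_def]

protected theorem zero_mul' (f : PathAlgebra K V) : 0 * f = 0 := by
  simp [mul_def]

protected theorem mul_zero' (f : PathAlgebra K V) : f * 0 = 0 := by
  simp [mul_def]

protected theorem smul_mul' (c : K) (f g : PathAlgebra K V) : (c • f) * g = c • (f * g) := by
  simp [mul_def]

protected theorem mul_smul' (c : K) (f g : PathAlgebra K V) : f * (c • g) = c • (f * g) := by
  simp [mul_def]

protected theorem mul_assoc' (f g h : PathAlgebra K V) : f * g * h = f * (g * h) := by
  induction f using induction_on with
  | zero => simp only [PathAlgebra.zero_mul']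
  | add f₁ f₂ h₁ h₂ => simp only [PathAlgebra.add_mul', h₁, h₂]
  | @smul c a b p =>
    induction g using induction_on with
    | zero => simp only [PathAlgebra.zero_mul', PathAlgebra.mul_zero']
    | add g₁ g₂ h₁ h₂ => simp only [PathAlgebra.add_mul', PathAlgebra.mul_add', h₁, h₂]
    | @smul d a' b' q =>
      induction h using induction_on with
      | zero => simp only [PathAlgebra.mul_zero']
      | add g₁ g₂ h₁ h₂ => simp only [PathAlgebra.mul_add', h₁, h₂]
      | @smul e a'' b'' r =>
        simp only [PathAlgebra.smul_mul', PathAlgebra.mul_smul']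
        congr 3
        by_cases h₁ : b = a'
        · subst h₁
          by_cases h₂ : b' = a''
          · subst h₂
            simp only [ofPath_mul_ofPath, Quiver.Path.comp_assoc]
          · simp only [ofPath_mul_ofPath, ofPath_mul_ofPath_of_ne _ _ h₂, PathAlgebra.mul_zero']
        · rw [ofPath_mul_ofPath_of_ne _ _ h₁, PathAlgebra.zero_mul']
          by_cases h₂ : b' = a''
          · subst h₂
            rw [ofPath_mul_ofPath, ofPath_mul_ofPath_of_ne _ _ h₁]
          · rw [ofPath_mul_ofPath_of_ne _ _ h₂, PathAlgebra.mul_zero']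

protected theorem one_mul' [Fintype V] (f : PathAlgebra K V) : 1 * f = f := by
  induction f using induction_on with
  | zero => simp only [PathAlgebra.mul_zero']
  | add f₁ f₂ h₁ h₂ => simp only [PathAlgebra.mul_add', h₁, h₂]
  | @smul c a b p =>
    rw [PathAlgebra.mul_smul']
    congr 1
    rw [one_def, mul_def, map_sum, LinearMap.sum_apply, Finset.sum_eq_single a]
    · rw [← mul_def, ofPath_mul_ofPath, Quiver.Path.nil_comp]
    · intro d _ hd
      rw [← mul_def, ofPath_mul_ofPath_of_ne _ _ hd]
    · simp

protected theorem mul_one' [Fintype V] (f : PathAlgebra K V) : f * 1 = f := by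
  induction f using induction_on with
  | zero => simp only [PathAlgebra.zero_mul']
  | add f₁ f₂ h₁ h₂ => simp only [PathAlgebra.add_mul', h₁, h₂]
  | @smul c a b p =>
    rw [PathAlgebra.smul_mul']
    congr 1
    rw [one_def, mul_def, map_sum, Finset.sum_eq_single b]
    · rw [← mul_def, ofPath_mul_ofPath, Quiver.Path.comp_nil]
    · intro d _ hd
      rw [← mul_def, ofPath_mul_ofPath_of_ne _ _ (Ne.symm hd)]
    · simp

instance [Fintype V] : Ring (PathAlgebra K V) :=
  { (inferInstance : AddCommGroup (PathAlgebra K V)),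
    (inferInstance : Mul (PathAlgebra K V)),
    (inferInstance : One (PathAlgebra K V)) with
    left_distrib := PathAlgebra.mul_add'
    right_distrib := PathAlgebra.add_mul'
    zero_mul := PathAlgebra.zero_mul'
    mul_zero := PathAlgebra.mul_zero'
    mul_assoc := PathAlgebra.mul_assoc'
    one_mul := PathAlgebra.one_mul'
    mul_one := PathAlgebra.mul_one' }

instance [Fintype V] : Algebra K (PathAlgebra K V) :=
  Algebra.ofModule PathAlgebra.smul_mul' PathAlgebra.mul_smul'

end PathAlgebra

/-! ### The circular quiver with double arrows and its bound quiver algebra -/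

/-- The vertices `0, 1, …, s - 1` of the circular quiver `Γ_s`, regarded modulo `s`. -/
def CircularVertex (s : ℕ) : Type := ZMod s

instance (s : ℕ) : CommRing (CircularVertex s) := inferInstanceAs (CommRing (ZMod s))

instance (s : ℕ) : DecidableEq (CircularVertex s) := inferInstanceAs (DecidableEq (ZMod s))

instance (s : ℕ) [NeZero s] : Fintype (CircularVertex s) := inferInstanceAs (Fintype (ZMod s))

/-- The arrows of the circular quiver `Γ_s`: for each vertex `i` there are exactly two arrows
`a_i, b_i : i ⟶ i + 1`. -/
inductive CircularArrow (s : ℕ) : CircularVertex s → CircularVertex s → Type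
  | a (i : CircularVertex s) : CircularArrow s i (i + 1)
  | b (i : CircularVertex s) : CircularArrow s i (i + 1)

/-- The circular quiver with double arrows `Γ_s`. -/
instance (s : ℕ) : Quiver (CircularVertex s) := ⟨CircularArrow s⟩

namespace CircularQuiver

variable (K : Type u) [Field K] (s : ℕ) [NeZero s]

/-- The arrow `a_i` as a path of length one. -/
def pathA (i : CircularVertex s) : Quiver.Path i (i + 1) :=
  Quiver.Hom.toPath (CircularArrow.a i : i ⟶ i + 1)

/-- The arrow `b_i` as a path of length one. -/
def pathB (i : CircularVertex s) : Quiver.Path i (i + 1) :=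
  Quiver.Hom.toPath (CircularArrow.b i : i ⟶ i + 1)

/-- The element `x = ∑ a_i` of the path algebra `K Γ_s`. -/
def x : PathAlgebra K (CircularVertex s) :=
  ∑ i : CircularVertex s, PathAlgebra.ofPath K (pathA s i)

/-- The element `y = ∑ b_i` of the path algebra `K Γ_s`. -/
def y : PathAlgebra K (CircularVertex s) :=
  ∑ i : CircularVertex s, PathAlgebra.ofPath K (pathB s i)

/-- The two-sided ideal `I = ⟨x², xy + yx, y²⟩` of the path algebra `K Γ_s`. -/
def relationIdeal : TwoSidedIdeal (PathAlgebra K (CircularVertex s)) :=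
  TwoSidedIdeal.span {x K s ^ 2, x K s * y K s + y K s * x K s, y K s ^ 2}

end CircularQuiver

/-- The bound quiver algebra `Λ_s = K Γ_s / I`. -/
abbrev CircularAlgebra (K : Type u) [Field K] (s : ℕ) [NeZero s] : Type u :=
  (CircularQuiver.relationIdeal K s).ringCon.Quotient

/-! ### Hochschild cohomology -/

/-- The enveloping algebra of a `K`-algebra `A`; its left modules are the `A`-`A`-bimodules on which
`K` acts centrally, the element `a ⊗ op b` acting by `m ↦ a m b`. -/
abbrev EnvelopingAlgebra (K : Type u) [Field K] (A : Type u) [Ring A] [Algebra K A] : Type u :=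
  A ⊗[K] Aᵐᵒᵖ

/-- The regular `A`-`A`-bimodule `A`, as a module over the enveloping algebra. -/
abbrev regularBimoduleModule (K : Type u) [Field K] (A : Type u) [Ring A] [Algebra K A] :
    Module (EnvelopingAlgebra K A) A :=
  TensorProduct.Algebra.module

theorem regularBimodule_tmul_smul (K : Type u) [Field K] (A : Type u) [Ring A] [Algebra K A]
    (a b m : A) :
    letI := regularBimoduleModule K A
    (a ⊗ₜ[K] op b : EnvelopingAlgebra K A) • m = a * m * b := by
  let := regularBimoduleModule K A
  change a • op b • m = a * m * b
  simp [mul_assoc]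

/-- The regular bimodule as an object of the category of modules over the enveloping algebra. -/
def regularBimodule (K : Type u) [Field K] (A : Type u) [Ring A] [Algebra K A] :
    ModuleCat.{u} (EnvelopingAlgebra K A) :=
  letI := regularBimoduleModule K A
  ModuleCat.of (EnvelopingAlgebra K A) A

/-- The `n`-th Hochschild cohomology group `HH^n(A) = Ext^n_{A^e}(A, A)`, as a `K`-vector space. -/
abbrev HochschildCohomology (K : Type u) [Field K] (A : Type u) [Ring A] [Algebra K A] (n : ℕ) :
    ModuleCat.{u} K :=
  ((Ext K (ModuleCat.{u} (EnvelopingAlgebra K A)) n).obj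
    (Opposite.op (regularBimodule K A))).obj (regularBimodule K A)

end

/-!
# Hochschild cohomology of the circular quiver algebra with anticommuting double arrows

Let `R = K^s` be the span of the trivial paths. As a vector space the algebra `Λ` is the direct sum
of the four shifted copies `λ R`, where `λ` runs over the monomials `1, x, y, xy`, so it is a
twisted version of the exterior algebra in two variables, and it is Koszul. The Koszul bimodule
resolution is `P_n = (Λᵉ ε_n)^(n+1)`, where `ε_n = ∑ e_i ⊗ e_{i+n}` is an idempotent of `Λᵉ`, with the
differential
`(d p)_j = p_{j+1} (x ⊗ 1 ± 1 ⊗ x) + p_j (y ⊗ 1 ± 1 ⊗ y)`. Writing elements of `Λᵉ ε_n` uniquely as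
`∑ (λ ⊗ u_λ) ε_n` with `u_λ ∈ Λ` (`expand`, `contract`) turns the differential into an explicit
map of `Λ`-valued sequences, and its exactness becomes a short computation
(`exists_of_mulBracket_eq_zero`, `exact_augmentation`).

Applying `Hom(-, Λ)` gives cochains `c : Fin (n + 1) → Λ` with values in `ε_n Λ = ⊕ e_i Λ e_{i+n}`,
which vanishes unless `n ≡ 0, 1, 2` modulo `s`. In the coordinates given by the monomials, the only
possibly nonzero coboundaries, those in the degrees `ms` and `ms + 1`, are copies of the single
operator `T r i = r i - (-1)^(ms) r (i - 1)` on `K^s`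
(`cochainCoord_one_coboundary`, `cochainCoord_three_coboundary`). The kernel of `T` is a line if
`(-1)^(ms * s) = 1` and zero otherwise (`finrank_ker_twistedDifference`), and the dimensions follow
by rank-nullity.

The remaining point is that the elements `λ e_i` form a basis of `Λ`. They span because their span
is stable under left multiplication by paths; they are independent because the path algebra acts on
a vector space with `4 s` coordinates through operators which satisfy the relations
(`coordMap_monomial_mul_e`).
-/

noncomputable section

open CategoryTheory MulOpposite
open scoped TensorProduct

/-! ### Algebras with the relations of the circular quiver -/

/-- Elements `e_i`, `x`, `y` of a ring that satisfy the relations of the circular quiver algebra: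
the `e_i` are orthogonal idempotents with sum one, passing `x` or `y` over an idempotent shifts its
index, and `x`, `y` anticommute and have square zero. -/
structure CircularRelations (s : ℕ) [NeZero s] (A : Type u) [Ring A] where
  e : CircularVertex s → A
  x : A
  y : A
  e_mul_e : ∀ i j, e i * e j = if i = j then e i else 0
  sum_e : ∑ i, e i = 1
  e_mul_x : ∀ i, e i * x = x * e (i + 1)
  e_mul_y : ∀ i, e i * y = y * e (i + 1)
  x_mul_x : x * x = 0
  y_mul_y : y * y = 0
  y_mul_x : y * x = -(x * y)

namespace CircularRelations

variable {s : ℕ} [NeZero s] {A : Type u} [Ring A] (D : CircularRelations s A)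

/-- The monomials `1, x, y, xy`. -/
def monomial : Fin 4 → A := ![1, D.x, D.y, D.x * D.y]

lemma e_mul_self (i : CircularVertex s) : D.e i * D.e i = D.e i := by simp [D.e_mul_e]

lemma e_mul_e_of_ne {i j : CircularVertex s} (h : i ≠ j) : D.e i * D.e j = 0 := by
  simp [D.e_mul_e, h]

lemma y_mul_x_assoc (a : A) : D.y * (D.x * a) = -(D.x * (D.y * a)) := by
  rw [← mul_assoc, D.y_mul_x, neg_mul, mul_assoc]

lemma x_mul_x_assoc (a : A) : D.x * (D.x * a) = 0 := by rw [← mul_assoc, D.x_mul_x, zero_mul]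

lemma y_mul_y_assoc (a : A) : D.y * (D.y * a) = 0 := by rw [← mul_assoc, D.y_mul_y, zero_mul]

/-- The lengths `0, 1, 1, 2` of the monomials `1, x, y, xy`, modulo `s`. -/
def degree (s : ℕ) : Fin 4 → CircularVertex s := ![0, 1, 1, 2]

lemma e_mul_monomial (i : CircularVertex s) (l : Fin 4) :
    D.e i * D.monomial l = D.monomial l * D.e (i + degree s l) := by
  fin_cases l
  · simp [monomial, degree]
  · simp [monomial, degree, D.e_mul_x]
  · simp [monomial, degree, D.e_mul_y]
  · simp only [monomial, degree, Fin.reduceFinMk, Matrix.cons_val]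
    rw [← mul_assoc, D.e_mul_x, mul_assoc, D.e_mul_y, mul_assoc, add_assoc, one_add_one_eq_two]

lemma x_mul_monomial_mul_e (l : Fin 4) (i : CircularVertex s) :
    D.x * (D.monomial l * D.e i) =
      ![D.monomial 1 * D.e i, 0, D.monomial 3 * D.e i, 0] l := by
  fin_cases l <;> simp [monomial, ← mul_assoc, D.x_mul_x]

lemma y_mul_monomial_mul_e (l : Fin 4) (i : CircularVertex s) :
    D.y * (D.monomial l * D.e i) =
      ![D.monomial 2 * D.e i, -(D.monomial 3 * D.e i), 0, 0] l := by
  fin_cases l <;> simp [monomial, mul_assoc, D.y_mul_x_assoc, D.y_mul_y_assoc]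

lemma monomial_mul_e_mul_x (l : Fin 4) (i : CircularVertex s) :
    D.monomial l * D.e i * D.x =
      ![D.monomial 1 * D.e (i + 1), 0, -(D.monomial 3 * D.e (i + 1)), 0] l := by
  fin_cases l <;>
    simp [monomial, mul_assoc, D.e_mul_x, D.y_mul_x_assoc, D.x_mul_x_assoc]

lemma monomial_mul_e_mul_y (l : Fin 4) (i : CircularVertex s) :
    D.monomial l * D.e i * D.y =
      ![D.monomial 2 * D.e (i + 1), D.monomial 3 * D.e (i + 1), 0, 0] l := by
  fin_cases l <;>
    simp [monomial, mul_assoc, D.e_mul_y, D.y_mul_y_assoc]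

end CircularRelations

/-- A presentation of a `K`-algebra as the circular quiver algebra: elements satisfying the
relations, together with coordinates with respect to the basis `λ e_i`, where `λ` runs over the
monomials `1, x, y, xy`. Note that the idempotents stand on the right of the monomials. -/
structure CircularPresentation (K : Type u) [Field K] (s : ℕ) [NeZero s] (A : Type u) [Ring A]
    [Algebra K A] extends CircularRelations s A where
  coord : A ≃ₗ[K] (Fin 4 → CircularVertex s → K)
  coord_symm_apply : ∀ r,
    coord.symm r = ∑ l, ∑ i, r l i • (toCircularRelations.monomial l * e i)

namespace CircularPresentation

open CircularRelations

variable {K : Type u} [Field K] {s : ℕ} [NeZero s] {A : Type u} [Ring A] [Algebra K A]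
  (D : CircularPresentation K s A)

lemma coord_monomial_mul_e (l : Fin 4) (i : CircularVertex s) :
    D.coord (D.monomial l * D.e i) = Pi.single l (Pi.single i 1) := by
  rw [← LinearEquiv.eq_symm_apply, D.coord_symm_apply, Finset.sum_eq_single l]
  · rw [Finset.sum_eq_single i]
    · simp
    · intro j _ hj
      simp [hj]
    · simp
  · intro k _ hk
    simp [hk]
  · simp

lemma eq_sum (a : A) : a = ∑ l, ∑ i, D.coord a l i • (D.monomial l * D.e i) := by
  conv_lhs => rw [← D.coord.symm_apply_apply a, D.coord_symm_apply]

/-! ### Projective bimodules and their coordinates -/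

/-- The idempotent `ε_n = ∑ e_i ⊗ e_{i+n}` of the enveloping algebra. The left ideal it generates is
the projective bimodule `⊕ A e_i ⊗ e_{i+n} A`. -/
def eps (n : ℕ) : EnvelopingAlgebra K A :=
  ∑ i, D.e i ⊗ₜ[K] op (D.e (i + (n : CircularVertex s)))

lemma e_tmul_one_mul_eps (n : ℕ) (i : CircularVertex s) :
    (D.e i ⊗ₜ[K] 1 : EnvelopingAlgebra K A) * D.eps n =
      D.e i ⊗ₜ[K] op (D.e (i + (n : CircularVertex s))) := by
  rw [eps, Finset.mul_sum, Finset.sum_eq_single i]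
  · simp [D.e_mul_self]
  · intro j _ hj
    simp [D.e_mul_e_of_ne hj.symm]
  · simp

lemma one_tmul_e_mul_eps (n : ℕ) (i : CircularVertex s) :
    (1 ⊗ₜ[K] op (D.e (i + (n : CircularVertex s))) : EnvelopingAlgebra K A) * D.eps n =
      D.e i ⊗ₜ[K] op (D.e (i + (n : CircularVertex s))) := by
  rw [eps, Finset.mul_sum, Finset.sum_eq_single i]
  · simp [← op_mul, D.e_mul_self]
  · intro j _ hj
    have : j + (n : CircularVertex s) ≠ i + n := by simpa using hj
    simp [← op_mul, D.e_mul_e_of_ne this]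
  · simp

lemma eps_mul_eps (n : ℕ) : D.eps n * D.eps n = D.eps n := by
  nth_rewrite 1 [eps]
  rw [Finset.sum_mul, eps]
  refine Finset.sum_congr rfl fun i _ => ?_
  have h : (D.e i ⊗ₜ[K] op (D.e (i + (n : CircularVertex s))) : EnvelopingAlgebra K A) =
    (1 ⊗ₜ[K] op (D.e (i + (n : CircularVertex s)))) * (D.e i ⊗ₜ[K] 1) := by simp
  nth_rewrite 1 [h]
  rw [mul_assoc, ← eps, e_tmul_one_mul_eps]
  simp [← op_mul, D.e_mul_self]

lemma eps_succ_mul_tmul_one (n : ℕ) {z : A} (hz : ∀ i, D.e i * z = z * D.e (i + 1)) :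
    D.eps (n + 1) * (z ⊗ₜ[K] 1) = (z ⊗ₜ[K] 1) * D.eps n := by
  have h : D.eps n = ∑ i, D.e (i + 1) ⊗ₜ[K] op (D.e (i + 1 + (n : CircularVertex s))) :=
    (Equiv.sum_comp (Equiv.addRight (1 : CircularVertex s))
      (fun i => D.e i ⊗ₜ[K] op (D.e (i + (n : CircularVertex s))))).symm
  rw [h, eps, Finset.sum_mul, Finset.mul_sum]
  refine Finset.sum_congr rfl fun i _ => ?_
  simp [hz, add_comm, add_left_comm]

lemma eps_succ_mul_one_tmul (n : ℕ) {z : A} (hz : ∀ i, D.e i * z = z * D.e (i + 1)) :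
    D.eps (n + 1) * (1 ⊗ₜ[K] op z) = (1 ⊗ₜ[K] op z) * D.eps n := by
  rw [eps, eps, Finset.sum_mul, Finset.mul_sum]
  refine Finset.sum_congr rfl fun i _ => ?_
  simp [← op_mul, hz, add_assoc]

/-- The element `z ⊗ 1 + 1 ⊗ q z` of the enveloping algebra, acting on `A` by `a ↦ z a + q a z`. -/
def bracket (q : K) (z : A) : EnvelopingAlgebra K A := z ⊗ₜ[K] 1 + 1 ⊗ₜ[K] op (q • z)

lemma eps_succ_mul_bracket (n : ℕ) (q : K) {z : A} (hz : ∀ i, D.e i * z = z * D.e (i + 1)) :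
    D.eps (n + 1) * bracket q z = bracket q z * D.eps n := by
  rw [bracket, mul_add, add_mul, D.eps_succ_mul_tmul_one n hz,
    D.eps_succ_mul_one_tmul n (z := q • z) fun i => by simp [hz]]

/-- The negation on the right is that of the ring structure on the enveloping algebra, which
`TensorProduct.tmul_neg` does not mention. -/
lemma tmul_op_neg_smul (q : K) (a b : A) :
    (a ⊗ₜ[K] op ((-q) • b) : EnvelopingAlgebra K A) = -(a ⊗ₜ[K] op (q • b)) := by
  rw [eq_neg_iff_add_eq_zero, ← TensorProduct.tmul_add, ← MulOpposite.op_add, ← add_smul]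
  simp

lemma bracket_mul_bracket (q q' : K) (z w : A) :
    bracket q z * bracket q' w = (z * w) ⊗ₜ[K] 1 + z ⊗ₜ[K] op (q' • w) + w ⊗ₜ[K] op (q • z) +
      1 ⊗ₜ[K] op ((q' * q) • (w * z)) := by
  simp only [bracket, mul_add, add_mul, Algebra.TensorProduct.tmul_mul_tmul, mul_one, one_mul,
    ← op_mul, smul_mul_smul_comm]
  abel

lemma bracket_mul_bracket_neg (q : K) {z : A} (hz : z * z = 0) :
    bracket q z * bracket (-q) z = 0 := by
  rw [bracket_mul_bracket, tmul_op_neg_smul]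
  simp [hz]

lemma bracket_mul_bracket_neg_add (q : K) {z w : A} (h : w * z = -(z * w)) :
    bracket q z * bracket (-q) w + bracket q w * bracket (-q) z = 0 := by
  have h₁ : ((w * z) ⊗ₜ[K] 1 + (z * w) ⊗ₜ[K] 1 : EnvelopingAlgebra K A) = 0 := by
    rw [← TensorProduct.add_tmul]; simp [h]
  have h₂ : (1 ⊗ₜ[K] op ((-q * q) • (w * z)) + 1 ⊗ₜ[K] op ((-q * q) • (z * w)) :
      EnvelopingAlgebra K A) = 0 := by
    rw [← TensorProduct.tmul_add, ← MulOpposite.op_add, ← smul_add]; simp [h]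
  rw [bracket_mul_bracket, bracket_mul_bracket, tmul_op_neg_smul, tmul_op_neg_smul]
  refine Eq.trans ?_ ((congrArg₂ (· + ·) h₁ h₂).trans (add_zero 0))
  abel

/-- The map `(u_λ) ↦ ∑ (λ ⊗ u_λ) ε_n` from quadruples of elements of `A` to the left ideal generated
by `ε_n`; by `contract_expand` and `expand_contract` it is bijective onto that ideal. -/
def expand (n : ℕ) : (Fin 4 → A) →+ EnvelopingAlgebra K A where
  toFun u := (∑ l, D.monomial l ⊗ₜ[K] op (u l)) * D.eps n
  map_zero' := by simp
  map_add' u v := by simp [TensorProduct.tmul_add, Finset.sum_add_distrib, add_mul]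

lemma expand_apply (n : ℕ) (u : Fin 4 → A) :
    D.expand n u = (∑ l, D.monomial l ⊗ₜ[K] op (u l)) * D.eps n := rfl

/-- The element `∑ r_i e_{i+n}` of `A`. -/
def vertexSum (n : ℕ) : (CircularVertex s → K) →ₗ[K] A where
  toFun r := ∑ i, r i • D.e (i + (n : CircularVertex s))
  map_add' u v := by simp [add_smul, Finset.sum_add_distrib]
  map_smul' c u := by simp [Finset.smul_sum, mul_smul]

lemma vertexSum_apply (n : ℕ) (r : CircularVertex s → K) :
    D.vertexSum n r = ∑ i, r i • D.e (i + (n : CircularVertex s)) := rfl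

/-- The inverse of `expand`: on a pure tensor it expands the left factor in the basis `λ e_i` and
moves the idempotents over to the right factor. -/
def contract (n : ℕ) : EnvelopingAlgebra K A →ₗ[K] (Fin 4 → A) :=
  TensorProduct.lift <| LinearMap.mk₂ K
    (fun a m l => D.vertexSum n (D.coord a l) * unop m)
    (fun a b m => by ext; simp [add_mul])
    (fun c a m => by ext; simp)
    (fun a m m' => by ext; simp [mul_add])
    (fun c a m => by ext; simp)

lemma contract_tmul (n : ℕ) (a m : A) (l : Fin 4) :
    D.contract n (a ⊗ₜ[K] op m) l = D.vertexSum n (D.coord a l) * m := by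
  simp [contract]

lemma mul_e_tmul_mul_eps (n : ℕ) (a m : A) (i : CircularVertex s) :
    ((a * D.e i) ⊗ₜ[K] op m : EnvelopingAlgebra K A) * D.eps n =
      (a ⊗ₜ[K] op (D.e (i + (n : CircularVertex s)) * m)) * D.eps n := by
  have h₁ : ((a * D.e i) ⊗ₜ[K] op m : EnvelopingAlgebra K A) =
    (a ⊗ₜ[K] op m) * (D.e i ⊗ₜ[K] 1) := by simp
  have h₂ : (a ⊗ₜ[K] op (D.e (i + (n : CircularVertex s)) * m) : EnvelopingAlgebra K A) =
    (a ⊗ₜ[K] op m) * (1 ⊗ₜ[K] op (D.e (i + (n : CircularVertex s)))) := by simp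
  rw [h₁, h₂, mul_assoc, mul_assoc, e_tmul_one_mul_eps, one_tmul_e_mul_eps]

lemma expand_contract (n : ℕ) (p : EnvelopingAlgebra K A) :
    D.expand n (D.contract n p) = p * D.eps n := by
  induction p using TensorProduct.induction_on with
  | zero => simp
  | add p q hp hq => rw [map_add, map_add, hp, hq, add_mul]
  | tmul a m =>
    induction m with | _ m => ?_
    conv_rhs => rw [D.eq_sum a]
    simp only [expand_apply, contract_tmul, vertexSum_apply, Finset.sum_mul, TensorProduct.sum_tmul]
    refine Finset.sum_congr rfl fun l _ => ?_
    simp only [Finset.op_sum, TensorProduct.tmul_sum, Finset.sum_mul]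
    refine Finset.sum_congr rfl fun i _ => ?_
    rw [TensorProduct.smul_tmul, ← op_smul, mul_e_tmul_mul_eps, smul_mul_assoc, mul_smul_comm]

lemma contract_expand (n : ℕ) (u : Fin 4 → A) : D.contract n (D.expand n u) = u := by
  ext l
  have h : D.expand n u = ∑ k, ∑ i, (D.monomial k * D.e i) ⊗ₜ[K]
      op (D.e (i + (n : CircularVertex s)) * u k) := by
    simp only [expand_apply, Finset.sum_mul, eps, Finset.mul_sum,
      Algebra.TensorProduct.tmul_mul_tmul, op_mul]
    rw [Finset.sum_comm]
  rw [h]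
  simp only [map_sum, Finset.sum_apply, contract_tmul, coord_monomial_mul_e]
  rw [Finset.sum_eq_single l]
  · have h' : ∀ i : CircularVertex s,
        D.vertexSum n (Pi.single i 1) = D.e (i + (n : CircularVertex s)) := by
      intro i
      rw [vertexSum_apply, Finset.sum_eq_single i] <;> simp +contextual
    simp only [Pi.single_eq_same, h', ← mul_assoc, e_mul_self]
    rw [← Finset.sum_mul]
    nth_rewrite 2 [← one_mul (u l)]
    rw [← D.sum_e]
    exact congrArg (· * u l) (Equiv.sum_comp (Equiv.addRight (n : CircularVertex s)) D.e)
  · intro k _ hk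
    simp [hk.symm]
  · simp

lemma expand_injective (n : ℕ) : Function.Injective (D.expand n) :=
  Function.LeftInverse.injective (D.contract_expand n)

end CircularPresentation

namespace CircularPresentation

open CircularRelations

attribute [local instance] regularBimoduleModule

variable {K : Type u} [Field K] {s : ℕ} [NeZero s] {A : Type u} [Ring A] [Algebra K A]
  (D : CircularPresentation K s A)

/-! ### Exactness in coordinates -/

/-- Right multiplication by `bracket q x`, in the coordinates of `expand`. -/
def mulBracketX (q : K) (a : Fin 4 → A) : Fin 4 → A :=
  ![q • (D.x * a 0), a 0 + q • (D.x * a 1), q • (D.x * a 2), -a 2 + q • (D.x * a 3)]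

/-- Right multiplication by `bracket q y`, in the coordinates of `expand`. -/
def mulBracketY (q : K) (a : Fin 4 → A) : Fin 4 → A :=
  ![q • (D.y * a 0), q • (D.y * a 1), a 0 + q • (D.y * a 2), a 1 + q • (D.y * a 3)]

lemma expand_mul_bracket_x (n : ℕ) (q : K) (a : Fin 4 → A) :
    D.expand (n + 1) a * bracket q D.x = D.expand n (D.mulBracketX q a) := by
  have h : (D.x * D.y) * D.x = 0 := by rw [mul_assoc, D.y_mul_x, mul_neg, D.x_mul_x_assoc, neg_zero]
  have h' : ((D.x * D.y) ⊗ₜ[K] op (-a 2) : EnvelopingAlgebra K A) =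
      (-(D.x * D.y)) ⊗ₜ[K] op (a 2) := by
    rw [← neg_one_smul K (a 2), op_smul, ← TensorProduct.smul_tmul, neg_one_smul]
  rw [expand_apply, mul_assoc, D.eps_succ_mul_bracket n q D.e_mul_x, ← mul_assoc, expand_apply]
  congr 1
  simp only [bracket, Fin.sum_univ_four, monomial, mulBracketX, Matrix.cons_val, mul_add, add_mul,
    Algebra.TensorProduct.tmul_mul_tmul, mul_one, one_mul, h, D.x_mul_x, D.y_mul_x, ← op_mul,
    MulOpposite.op_add, TensorProduct.tmul_add, TensorProduct.zero_tmul, smul_mul_assoc, h']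
  abel

lemma expand_mul_bracket_y (n : ℕ) (q : K) (a : Fin 4 → A) :
    D.expand (n + 1) a * bracket q D.y = D.expand n (D.mulBracketY q a) := by
  have h : (D.x * D.y) * D.y = 0 := by rw [mul_assoc, D.y_mul_y, mul_zero]
  rw [expand_apply, mul_assoc, D.eps_succ_mul_bracket n q D.e_mul_y, ← mul_assoc, expand_apply]
  congr 1
  simp only [bracket, Fin.sum_univ_four, monomial, mulBracketY, Matrix.cons_val, mul_add, add_mul,
    Algebra.TensorProduct.tmul_mul_tmul, mul_one, one_mul, h, D.y_mul_y, ← op_mul,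
    MulOpposite.op_add, TensorProduct.tmul_add, TensorProduct.zero_tmul, smul_mul_assoc]
  abel

/-- Exactness of the Koszul complex in positive degrees, in coordinates. For `U = (u, v, w, t)` a
preimage of the shape `(u', v', 0, 0)` is found: `v'` is chosen to produce `t`, after which the
cocycle condition says exactly that the remaining `v` and `w` are two restrictions of a common
sequence `u'`; the component `u` is then automatically correct. -/
lemma exists_of_mulBracket_eq_zero {n : ℕ} (q : K) (U : Fin (n + 2) → Fin 4 → A)
    (hU : ∀ j : Fin (n + 1),
      D.mulBracketX (-q) (U j.succ) + D.mulBracketY (-q) (U j.castSucc) = 0) :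
    ∃ W : Fin (n + 3) → Fin 4 → A, ∀ j : Fin (n + 2),
      D.mulBracketX q (W j.succ) + D.mulBracketY q (W j.castSucc) = U j := by
  have h₁ : ∀ j : Fin (n + 1), U j.succ 0 =
      q • (D.x * U j.succ 1) + q • (D.y * U j.castSucc 1) := fun j => by
    have := congrFun (hU j) 1
    simp only [mulBracketX, mulBracketY, Pi.add_apply, Matrix.cons_val, Pi.zero_apply, neg_smul]
      at this
    rw [← sub_eq_zero, ← this]; abel
  have h₂ : ∀ j : Fin (n + 1), U j.castSucc 0 =
      q • (D.x * U j.succ 2) + q • (D.y * U j.castSucc 2) := fun j => by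
    have := congrFun (hU j) 2
    simp only [mulBracketX, mulBracketY, Pi.add_apply, Matrix.cons_val, Pi.zero_apply, neg_smul]
      at this
    rw [← sub_eq_zero, ← this]; abel
  have h₃ : ∀ j : Fin (n + 1), U j.succ 2 = U j.castSucc 1 -
      q • (D.x * U j.succ 3) - q • (D.y * U j.castSucc 3) := fun j => by
    have := congrFun (hU j) 3
    simp only [mulBracketX, mulBracketY, Pi.add_apply, Matrix.cons_val, Pi.zero_apply, neg_smul]
      at this
    rw [← sub_eq_zero, ← neg_eq_zero, ← this]; abel
  -- `u'` and `v'` are the first two coordinates of the preimage; `v₁` is what is left of the second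
  -- coordinate of `U` once the contribution of `v'` is removed
  let v' : Fin (n + 3) → A := Fin.snoc (α := fun _ => A) (fun j => U j 3) 0
  let v₁ : Fin (n + 2) → A := fun j =>
    U j 1 - q • (D.x * v' j.succ) - q • (D.y * v' j.castSucc)
  let u' : Fin (n + 3) → A := Fin.cons (U 0 2) v₁
  have hv' : ∀ j : Fin (n + 2), v' j.castSucc = U j 3 := fun j => by simp [v']
  have hu₁ : ∀ j : Fin (n + 2), u' j.succ = v₁ j := fun j => by simp [u']
  have hu₂ : ∀ j : Fin (n + 2), u' j.castSucc = U j 2 := by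
    intro j
    cases j using Fin.cases with
    | zero => simp [u']
    | succ i =>
      rw [← Fin.succ_castSucc, hu₁, h₃]
      simp only [v₁, Fin.succ_castSucc, hv']
  have hu₀ : ∀ j : Fin (n + 2),
      U j 0 = q • (D.x * u' j.succ) + q • (D.y * u' j.castSucc) := by
    intro j
    cases j using Fin.cases with
    | zero =>
      have h := h₂ 0
      rw [Fin.castSucc_zero] at h
      rw [h, hu₂, ← hu₂]
      rfl
    | succ i =>
      rw [h₁, hu₁, ← Fin.succ_castSucc, hu₁]
      simp only [v₁, mul_sub, smul_sub, mul_smul_comm, D.x_mul_x_assoc, D.y_mul_y_assoc,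
        D.y_mul_x_assoc, smul_zero, smul_neg, Fin.succ_castSucc]
      abel
  refine ⟨fun j => ![u' j, v' j, 0, 0], fun j => ?_⟩
  ext l
  fin_cases l
  · simp [mulBracketX, mulBracketY, hu₀ j]
  · simp only [Fin.mk_one, mulBracketX, mulBracketY, hu₁, v₁, Pi.add_apply, Matrix.cons_val]
    abel
  · simp [mulBracketX, mulBracketY, hu₂]
  · simp [mulBracketX, mulBracketY, hv']

/-! ### The Koszul bimodule resolution -/

/-- The `n`-th term of the Koszul resolution, the direct sum of `n + 1` copies of the left ideal
generated by `ε_n`. The copy with index `j` belongs to the sum of all words in `x` and `y` of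
length `n` with `j` letters `x`. -/
def koszulModule (n : ℕ) :
    Submodule (EnvelopingAlgebra K A) (Fin (n + 1) → EnvelopingAlgebra K A) where
  carrier := {p | ∀ j, p j * D.eps n = p j}
  add_mem' hp hq j := by simp [add_mul, hp j, hq j]
  zero_mem' j := by simp
  smul_mem' c p hp j := by simp [mul_assoc, hp j]

/-- The formula of the Koszul differential, on sequences with arbitrary entries. -/
def koszulDifferentialAux (n : ℕ) (q : K) : (Fin (n + 2) → EnvelopingAlgebra K A)
    →ₗ[EnvelopingAlgebra K A] (Fin (n + 1) → EnvelopingAlgebra K A) where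
  toFun p j := p j.succ * bracket q D.x + p j.castSucc * bracket q D.y
  map_add' p p' := by ext j; simp only [Pi.add_apply, add_mul]; abel
  map_smul' c p := by ext j; simp [mul_add, mul_assoc]

/-- The differential of the Koszul resolution. -/
def koszulDifferential (n : ℕ) :
    D.koszulModule (n + 1) →ₗ[EnvelopingAlgebra K A] D.koszulModule n :=
  (D.koszulDifferentialAux n ((-1) ^ (n + 1))).restrict fun p hp j => by
    simp only [koszulDifferentialAux, LinearMap.coe_mk, AddHom.coe_mk]
    rw [← hp j.succ, ← hp j.castSucc, mul_assoc, mul_assoc, D.eps_succ_mul_bracket n _ D.e_mul_x,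
      D.eps_succ_mul_bracket n _ D.e_mul_y, add_mul]
    simp only [mul_assoc, D.eps_mul_eps]

lemma koszulDifferential_apply (n : ℕ) (p : D.koszulModule (n + 1)) (j : Fin (n + 1)) :
    (D.koszulDifferential n p).1 j =
      p.1 j.succ * bracket ((-1) ^ (n + 1)) D.x + p.1 j.castSucc * bracket ((-1) ^ (n + 1)) D.y :=
  rfl

lemma koszulDifferential_comp (n : ℕ) (p : D.koszulModule (n + 2)) :
    D.koszulDifferential n (D.koszulDifferential (n + 1) p) = 0 := by
  ext j
  have h : ((-1) ^ (n + 1) : K) = -(-1) ^ (n + 1 + 1) := by ring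
  simp only [koszulDifferential_apply, add_mul, mul_assoc, Fin.succ_castSucc]
  have hx := bracket_mul_bracket_neg ((-1) ^ (n + 1 + 1) : K) D.x_mul_x
  have hy := bracket_mul_bracket_neg ((-1) ^ (n + 1 + 1) : K) D.y_mul_y
  have hxy := bracket_mul_bracket_neg_add ((-1) ^ (n + 1 + 1) : K) D.y_mul_x
  rw [← h] at hx hy hxy
  rw [hx, hy, mul_zero, mul_zero, zero_add, add_zero, ← mul_add,
    add_comm (_ * _), hxy, mul_zero]
  rfl

lemma mem_koszulModule_expand (n : ℕ) (U : Fin (n + 1) → Fin 4 → A) :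
    (fun j => D.expand n (U j)) ∈ D.koszulModule n := fun j => by
  simp only [expand_apply, mul_assoc, D.eps_mul_eps]

lemma koszulModule_apply_eq_expand {n : ℕ} (p : D.koszulModule n) (j : Fin (n + 1)) :
    p.1 j = D.expand n (D.contract n (p.1 j)) := by
  rw [expand_contract, p.2 j]

lemma koszulDifferential_apply_eq_expand (n : ℕ) (p : D.koszulModule (n + 1)) (j : Fin (n + 1)) :
    (D.koszulDifferential n p).1 j =
      D.expand n (D.mulBracketX ((-1) ^ (n + 1)) (D.contract (n + 1) (p.1 j.succ)) +
        D.mulBracketY ((-1) ^ (n + 1)) (D.contract (n + 1) (p.1 j.castSucc))) := by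
  rw [map_add, ← expand_mul_bracket_x, ← expand_mul_bracket_y, ← koszulModule_apply_eq_expand,
    ← koszulModule_apply_eq_expand, koszulDifferential_apply]

lemma exact_koszulDifferential (n : ℕ) (p : D.koszulModule (n + 1))
    (hp : D.koszulDifferential n p = 0) :
    ∃ p' : D.koszulModule (n + 2), D.koszulDifferential (n + 1) p' = p := by
  have h : ((-1) ^ (n + 1) : K) = -(-1) ^ (n + 1 + 1) := by ring
  obtain ⟨W, hW⟩ := D.exists_of_mulBracket_eq_zero ((-1) ^ (n + 1 + 1) : K)
    (fun j => D.contract (n + 1) (p.1 j)) fun j => by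
      have := congrFun (congrArg Subtype.val hp) j
      rw [koszulDifferential_apply_eq_expand, h] at this
      exact D.expand_injective n (this.trans (map_zero _).symm)
  refine ⟨⟨_, D.mem_koszulModule_expand (n + 2) W⟩, ?_⟩
  ext j
  rw [koszulDifferential_apply, D.koszulModule_apply_eq_expand p, ← hW j, map_add,
    ← expand_mul_bracket_x, ← expand_mul_bracket_y]

/-- The augmentation of the Koszul resolution, induced by the multiplication of `A`. -/
def augmentation : D.koszulModule 0 →ₗ[EnvelopingAlgebra K A] A where
  toFun p := p.1 0 • (1 : A)
  map_add' p q := by simp [add_smul]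
  map_smul' c p := by simp [mul_smul]

lemma augmentation_apply (p : D.koszulModule 0) : D.augmentation p = p.1 0 • (1 : A) := rfl

lemma tmul_smul (a b m : A) :
    (a ⊗ₜ[K] op b : EnvelopingAlgebra K A) • m = a * m * b :=
  regularBimodule_tmul_smul K A a b m

lemma eps_zero_smul_one : D.eps 0 • (1 : A) = 1 := by
  rw [eps, Finset.sum_smul, ← D.sum_e]
  refine Finset.sum_congr rfl fun i _ => ?_
  rw [D.sum_e, tmul_smul]
  simp [D.e_mul_self]

lemma expand_zero_smul_one (a : Fin 4 → A) :
    D.expand 0 a • (1 : A) = a 0 + D.x * a 1 + D.y * a 2 + D.x * (D.y * a 3) := by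
  rw [expand_apply, mul_smul, eps_zero_smul_one, Finset.sum_smul]
  simp [Fin.sum_univ_four, tmul_smul, monomial, mul_assoc]

lemma augmentation_koszulDifferential (p : D.koszulModule 1) :
    D.augmentation (D.koszulDifferential 0 p) = 0 := by
  rw [augmentation_apply, koszulDifferential_apply_eq_expand, expand_zero_smul_one]
  simp [mulBracketX, mulBracketY, mul_add, D.x_mul_x_assoc, D.y_mul_x_assoc, D.y_mul_y_assoc]
  abel

lemma exact_augmentation (p : D.koszulModule 0) (hp : D.augmentation p = 0) :
    ∃ p' : D.koszulModule 1, D.koszulDifferential 0 p' = p := by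
  rw [augmentation_apply, D.koszulModule_apply_eq_expand, expand_zero_smul_one] at hp
  set a := D.contract 0 (p.1 0) with ha
  -- the index `0` carries the generator belonging to `y`, the index `1` the one belonging to `x`
  refine ⟨⟨_, D.mem_koszulModule_expand 1 ![![a 2, a 3, 0, 0], ![a 1 + D.y * a 3, 0, 0, 0]]⟩, ?_⟩
  ext j
  obtain rfl : j = 0 := Fin.fin_one_eq_zero j
  rw [koszulDifferential_apply, D.koszulModule_apply_eq_expand p, ← ha,
    expand_mul_bracket_x, expand_mul_bracket_y, ← map_add]
  congr 1
  have h : a 0 = -(D.x * (a 1 + D.y * a 3) + D.y * a 2) := by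
    rw [eq_neg_iff_add_eq_zero, ← hp, mul_add]; abel
  ext l
  fin_cases l
  · simp [mulBracketX, mulBracketY, h, add_comm]
  all_goals simp [mulBracketX, mulBracketY]

lemma augmentation_surjective : Function.Surjective D.augmentation := fun a =>
  ⟨⟨_, D.mem_koszulModule_expand 0 fun _ => ![a, 0, 0, 0]⟩, by
    simp [augmentation_apply, expand_zero_smul_one]⟩

instance koszulModule_projective (n : ℕ) :
    Module.Projective (EnvelopingAlgebra K A) (D.koszulModule n) := by
  let r : (Fin (n + 1) → EnvelopingAlgebra K A) →ₗ[EnvelopingAlgebra K A] D.koszulModule n :=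
    { toFun := fun p => ⟨fun j => p j * D.eps n, fun j => by simp [mul_assoc, D.eps_mul_eps]⟩
      map_add' := fun p q => by ext j; simp [add_mul]
      map_smul' := fun c p => by ext j; simp [mul_assoc] }
  refine Module.Projective.of_split (D.koszulModule n).subtype r ?_
  ext p j
  exact p.2 j

end CircularPresentation

/-! ### Dimensions of kernels, ranges and homology -/

lemma finrank_ker_eq_of_equiv {K V W V' W' : Type*} [Field K] [AddCommGroup V] [Module K V]
    [AddCommGroup W] [Module K W] [AddCommGroup V'] [Module K V'] [AddCommGroup W'] [Module K W']
    (f : V →ₗ[K] W) (f' : V' →ₗ[K] W') (e : V ≃ₗ[K] V') (e' : W ≃ₗ[K] W')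
    (h : ∀ v, e' (f v) = f' (e v)) :
    Module.finrank K (LinearMap.ker f) = Module.finrank K (LinearMap.ker f') := by
  refine LinearEquiv.finrank_eq (LinearEquiv.ofSubmodules e _ _ ?_)
  ext v
  rw [Submodule.mem_map_equiv, LinearMap.mem_ker, LinearMap.mem_ker, ← e'.map_eq_zero_iff, h,
    e.apply_symm_apply]

lemma finrank_range_eq_of_equiv {K V W V' W' : Type*} [Field K] [AddCommGroup V] [Module K V]
    [AddCommGroup W] [Module K W] [AddCommGroup V'] [Module K V'] [AddCommGroup W'] [Module K W']
    (f : V →ₗ[K] W) (f' : V' →ₗ[K] W') (e : V ≃ₗ[K] V') (e' : W ≃ₗ[K] W')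
    (h : ∀ v, e' (f v) = f' (e v)) :
    Module.finrank K (LinearMap.range f) = Module.finrank K (LinearMap.range f') := by
  refine LinearEquiv.finrank_eq (LinearEquiv.ofSubmodules e' _ _ ?_)
  rw [← LinearEquiv.range_comp e f', ← LinearMap.range_comp]
  exact congrArg LinearMap.range (LinearMap.ext h)

/-- The dimension of the homology of a short complex of vector spaces, stated without
subtraction. -/
lemma finite_homology_and_finrank_add_finrank_range {K : Type u} [Field K]
    (S : ShortComplex (ModuleCat.{u} K)) [Module.Finite K S.X₂] :
    Module.Finite K S.homology ∧ Module.finrank K S.homology +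
      Module.finrank K (LinearMap.range S.f.hom) = Module.finrank K (LinearMap.ker S.g.hom) := by
  let E : S.homology ≃ₗ[K] (LinearMap.ker S.g.hom ⧸ LinearMap.range S.moduleCatToCycles) :=
    S.moduleCatHomologyIso.toLinearEquiv
  refine ⟨Module.Finite.equiv E.symm, ?_⟩
  have h : Module.finrank K (LinearMap.range S.f.hom) =
      Module.finrank K (LinearMap.range S.moduleCatToCycles) := by
    have : LinearMap.range S.f.hom =
        (LinearMap.range S.moduleCatToCycles).map (LinearMap.ker S.g.hom).subtype := by
      rw [← LinearMap.range_comp]; rfl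
    rw [this]
    exact Submodule.finrank_map_subtype_eq _ _
  rw [E.finrank_eq, h, Submodule.finrank_quotient_add_finrank]

namespace CircularPresentation

open CircularRelations

attribute [local instance] regularBimoduleModule

variable {K : Type u} [Field K] {s : ℕ} [NeZero s] {A : Type u} [Ring A] [Algebra K A]
  (D : CircularPresentation K s A)

/-! ### The Koszul complex as a projective resolution -/

/-- The Koszul complex of bimodules. -/
def koszulComplex : ChainComplex (ModuleCat.{u} (EnvelopingAlgebra K A)) ℕ :=
  ChainComplex.of (fun n => ModuleCat.of (EnvelopingAlgebra K A) (D.koszulModule n))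
    (fun n => ModuleCat.ofHom (D.koszulDifferential n)) fun n => by
      ext p : 2
      exact D.koszulDifferential_comp n p

lemma koszulComplex_d (n : ℕ) :
    D.koszulComplex.d (n + 1) n = ModuleCat.ofHom (D.koszulDifferential n) :=
  ChainComplex.of_d (fun n => ModuleCat.of (EnvelopingAlgebra K A) (D.koszulModule n))
    (fun n => ModuleCat.ofHom (D.koszulDifferential n)) n

/-- The augmentation as a map from the Koszul complex to the regular bimodule in degree zero. -/
def koszulAugmentation :
    D.koszulComplex ⟶ (ChainComplex.single₀ _).obj (regularBimodule K A) :=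
  (D.koszulComplex.toSingle₀Equiv _).symm ⟨ModuleCat.ofHom D.augmentation, by
    rw [koszulComplex_d]
    ext p : 2
    exact D.augmentation_koszulDifferential p⟩

lemma koszulAugmentation_f_zero :
    D.koszulAugmentation.f 0 = ModuleCat.ofHom D.augmentation :=
  by
  simp [koszulAugmentation, ChainComplex.toSingle₀Equiv, HomologicalComplex.mkHomToSingle]
  exact Category.comp_id _

lemma quasiIso_koszulAugmentation : QuasiIso D.koszulAugmentation where
  quasiIsoAt n := by
    cases n with
    | zero =>
      rw [ChainComplex.quasiIsoAt₀_iff, ShortComplex.quasiIso_iff_of_zeros' _ rfl rfl rfl]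
      constructor
      · rw [ShortComplex.moduleCat_exact_iff]
        intro p hp
        change (D.koszulAugmentation.f 0).hom p = 0 at hp
        rw [koszulAugmentation_f_zero] at hp
        obtain ⟨p', hp'⟩ := D.exact_augmentation p hp
        refine ⟨p', ?_⟩
        change (D.koszulComplex.d 1 0).hom p' = p
        rw [koszulComplex_d]
        exact hp'
      · rw [ModuleCat.epi_iff_surjective]
        change Function.Surjective (D.koszulAugmentation.f 0).hom
        rw [koszulAugmentation_f_zero]
        exact D.augmentation_surjective
    | succ n =>
      rw [quasiIsoAt_iff_exactAt' (hL := ChainComplex.exactAt_succ_single_obj ..),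
        HomologicalComplex.exactAt_iff' _ (n + 2) (n + 1) n (by simp) (by simp),
        ShortComplex.moduleCat_exact_iff]
      intro p hp
      change (D.koszulComplex.d (n + 1) n).hom p = 0 at hp
      rw [koszulComplex_d] at hp
      obtain ⟨p', hp'⟩ := D.exact_koszulDifferential n p hp
      refine ⟨p', ?_⟩
      change (D.koszulComplex.d (n + 2) (n + 1)).hom p' = p
      rw [koszulComplex_d]
      exact hp'

/-- The Koszul resolution of the regular bimodule. -/
def koszulResolution : ProjectiveResolution (regularBimodule K A) where
  complex := D.koszulComplex
  projective n := (IsProjective.iff_projective (R := EnvelopingAlgebra K A) _).1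
    (D.koszulModule_projective n)
  π := D.koszulAugmentation
  quasiIso := D.quasiIso_koszulAugmentation

/-! ### Cochains of the Koszul resolution -/

/-- The action of `ε_n` on `A`: the projection `a ↦ ∑ e_i a e_{i+n}` onto `⊕ e_i A e_{i+n}`. -/
def component (n : ℕ) : A →ₗ[K] A where
  toFun a := ∑ i, D.e i * a * D.e (i + (n : CircularVertex s))
  map_add' a b := by simp [mul_add, add_mul, Finset.sum_add_distrib]
  map_smul' c a := by simp [Finset.smul_sum]

lemma component_apply (n : ℕ) (a : A) :
    D.component n a = ∑ i, D.e i * a * D.e (i + (n : CircularVertex s)) := rfl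

lemma eps_smul (n : ℕ) (a : A) : D.eps n • a = D.component n a := by
  simp only [eps, Finset.sum_smul, tmul_smul, component_apply]

/-- The Koszul cochains of degree `n`: sequences with entries in `⊕ e_i A e_{i+n}`. -/
def cochains (n : ℕ) : Submodule K (Fin (n + 1) → A) where
  carrier := {c | ∀ j, D.component n (c j) = c j}
  add_mem' hp hq j := by simp [hp j, hq j]
  zero_mem' j := by simp
  smul_mem' c p hp j := by simp [hp j]

/-- The map `a ↦ z a + q a z`; the parameter `q` is a sign in all applications. -/
def twistedCommutator (q : K) (z : A) : A →ₗ[K] A :=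
  LinearMap.mulLeft K z + q • LinearMap.mulRight K z

lemma twistedCommutator_apply (q : K) (z a : A) :
    twistedCommutator q z a = z * a + q • (a * z) := rfl

lemma bracket_smul (q : K) (z a : A) :
    (bracket q z : EnvelopingAlgebra K A) • a = twistedCommutator q z a := by
  rw [bracket, add_smul, ← MulOpposite.op_one, tmul_smul, tmul_smul]
  simp [twistedCommutator_apply]

/-- Extension of a finite sequence by zero at the beginning. -/
def consZero (K : Type u) [Field K] {M : Type u} [AddCommGroup M] [Module K M] (n : ℕ) :
    (Fin n → M) →ₗ[K] (Fin (n + 1) → M) where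
  toFun c := Fin.cons 0 c
  map_add' c c' := by ext j; cases j using Fin.cases <;> simp
  map_smul' r c := by ext j; cases j using Fin.cases <;> simp

/-- Extension of a finite sequence by zero at the end. -/
def snocZero (K : Type u) [Field K] {M : Type u} [AddCommGroup M] [Module K M] (n : ℕ) :
    (Fin n → M) →ₗ[K] (Fin (n + 1) → M) where
  toFun c := Fin.snoc (α := fun _ => M) c 0
  map_add' c c' := by ext j; cases j using Fin.lastCases <;> simp
  map_smul' r c := by ext j; cases j using Fin.lastCases <;> simp

section
variable {M : Type u} [AddCommGroup M] [Module K M] {n : ℕ} (c : Fin n → M)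

@[simp] lemma consZero_zero : consZero K n c 0 = 0 := rfl
@[simp] lemma consZero_succ (j : Fin n) : consZero K n c j.succ = c j := rfl
@[simp] lemma snocZero_castSucc (j : Fin n) : snocZero K n c j.castSucc = c j := by
  simp [snocZero]
@[simp] lemma snocZero_last : snocZero K n c (Fin.last n) = 0 := by simp [snocZero]
end

/-- The formula of the Koszul coboundary, on sequences with arbitrary entries. -/
def coboundaryAux (n : ℕ) (q : K) : (Fin (n + 1) → A) →ₗ[K] (Fin (n + 2) → A) :=
  consZero K (n + 1) ∘ₗ (twistedCommutator q D.x).compLeft (Fin (n + 1)) +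
    snocZero K (n + 1) ∘ₗ (twistedCommutator q D.y).compLeft (Fin (n + 1))

lemma component_twistedCommutator (n : ℕ) (q : K) {z : A}
    (hz : ∀ i, D.e i * z = z * D.e (i + 1)) (a : A) :
    D.component (n + 1) (twistedCommutator q z a) =
      twistedCommutator q z (D.component n a) := by
  rw [← bracket_smul, ← bracket_smul, ← eps_smul, ← eps_smul, ← mul_smul,
    D.eps_succ_mul_bracket n q hz, mul_smul]

/-- The coboundary of the Koszul cochains, transposed to the Koszul differential. -/
def coboundary (n : ℕ) : D.cochains n →ₗ[K] D.cochains (n + 1) :=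
  (D.coboundaryAux n ((-1) ^ (n + 1))).restrict fun c hc j => by
    simp only [coboundaryAux, LinearMap.add_apply, LinearMap.comp_apply, Pi.add_apply, map_add]
    congr 1
    · cases j using Fin.cases with
      | zero => simp
      | succ j =>
        simp only [consZero_succ, LinearMap.compLeft_apply, Function.comp_apply]
        rw [D.component_twistedCommutator n _ D.e_mul_x, hc j]
    · cases j using Fin.lastCases with
      | last => simp
      | cast j =>
        simp only [snocZero_castSucc, LinearMap.compLeft_apply, Function.comp_apply]
        rw [D.component_twistedCommutator n _ D.e_mul_y, hc j]

lemma coboundary_val (n : ℕ) (c : D.cochains n) :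
    (D.coboundary n c).1 =
      consZero K (n + 1) (fun j => twistedCommutator ((-1 : K) ^ (n + 1)) D.x (c.1 j)) +
      snocZero K (n + 1) (fun j => twistedCommutator ((-1 : K) ^ (n + 1)) D.y (c.1 j)) := rfl

/-- The generator `ε_n` of the summand with index `j` of the `n`-th Koszul bimodule. -/
def generator (n : ℕ) (j : Fin (n + 1)) : D.koszulModule n :=
  ⟨Pi.single j (D.eps n), fun i => by
    obtain rfl | h := eq_or_ne i j
    · simp [D.eps_mul_eps]
    · simp [h]⟩

lemma eq_sum_generator {n : ℕ} (p : D.koszulModule n) : p = ∑ j, p.1 j • D.generator n j := by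
  ext i
  rw [AddSubmonoidClass.coe_finsetSum, Finset.sum_apply, Finset.sum_eq_single i]
  · simp [generator, p.2 i]
  · intro j _ hj
    simp [generator, hj.symm]
  · simp

/-- The values of a bimodule map on the generators. -/
def cochainOfHom (n : ℕ) (f : D.koszulModule n →ₗ[EnvelopingAlgebra K A] A) : D.cochains n :=
  ⟨fun j => f (D.generator n j), fun j => by
    rw [← eps_smul, ← map_smul]
    congr 1
    ext i
    obtain rfl | h := eq_or_ne i j
    · simp [generator, D.eps_mul_eps]
    · simp [generator, h]⟩

/-- The bimodule map with prescribed values on the generators. -/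
def homOfCochain (n : ℕ) (c : D.cochains n) : D.koszulModule n →ₗ[EnvelopingAlgebra K A] A where
  toFun p := ∑ j, p.1 j • c.1 j
  map_add' p p' := by simp [add_smul, Finset.sum_add_distrib]
  map_smul' a p := by simp [mul_smul, Finset.smul_sum]

lemma homOfCochain_apply (n : ℕ) (c : D.cochains n) (p : D.koszulModule n) :
    D.homOfCochain n c p = ∑ j, p.1 j • c.1 j := rfl

lemma homOfCochain_cochainOfHom (n : ℕ) (f : D.koszulModule n →ₗ[EnvelopingAlgebra K A] A) :
    D.homOfCochain n (D.cochainOfHom n f) = f := by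
  ext p
  conv_rhs => rw [D.eq_sum_generator p, map_sum]
  simp only [map_smul]
  rfl

lemma cochainOfHom_homOfCochain (n : ℕ) (c : D.cochains n) :
    D.cochainOfHom n (D.homOfCochain n c) = c := by
  ext j
  change ∑ i, (D.generator n j).1 i • c.1 i = c.1 j
  rw [Finset.sum_eq_single j]
  · simp [generator, eps_smul, c.2 j]
  · intro i _ hi
    simp only [generator, Pi.single_eq_of_ne hi]
    exact zero_smul (EnvelopingAlgebra K A) (c.1 i)
  · simp

lemma homOfCochain_koszulDifferential (n : ℕ) (c : D.cochains n) (p : D.koszulModule (n + 1)) :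
    D.homOfCochain n c (D.koszulDifferential n p) =
      D.homOfCochain (n + 1) (D.coboundary n c) p := by
  simp only [homOfCochain_apply, koszulDifferential_apply, coboundary_val, Pi.add_apply, smul_add,
    add_smul, mul_smul, bracket_smul, Finset.sum_add_distrib]
  congr 1
  · rw [Fin.sum_univ_succ (n := n + 1)]
    simp
  · rw [Fin.sum_univ_castSucc (n := n + 1)]
    simp

/-- Bimodule maps from the `n`-th Koszul bimodule to `A` are the Koszul cochains of degree `n`. -/
def homEquiv (n : ℕ) :
    (D.koszulComplex.X n ⟶ regularBimodule K A) ≃ₗ[K] D.cochains n where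
  toFun f := D.cochainOfHom n f.hom
  map_add' f g := rfl
  map_smul' r f := by
    ext j
    let a : A := f.hom (D.generator n j)
    change (algebraMap K (EnvelopingAlgebra K A) r) • a = r • a
    rw [Algebra.TensorProduct.algebraMap_apply, ← MulOpposite.op_one, tmul_smul, mul_one,
      Algebra.smul_def]
  invFun c := ModuleCat.ofHom (D.homOfCochain n c)
  left_inv f := by
    ext p : 2
    exact congrArg (fun g : D.koszulModule n →ₗ[EnvelopingAlgebra K A] A => g p)
      (D.homOfCochain_cochainOfHom n f.hom)
  right_inv c := D.cochainOfHom_homOfCochain n c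

lemma homEquiv_d_comp (n : ℕ) (f : D.koszulComplex.X n ⟶ regularBimodule K A) :
    D.homEquiv (n + 1) (D.koszulComplex.d (n + 1) n ≫ f) = D.coboundary n (D.homEquiv n f) := by
  obtain ⟨c, rfl⟩ := (D.homEquiv n).symm.surjective f
  rw [LinearEquiv.apply_symm_apply, ← LinearEquiv.eq_symm_apply, koszulComplex_d]
  ext p : 2
  exact D.homOfCochain_koszulDifferential n c p

theorem module_finite (D : CircularPresentation K s A) : Module.Finite K A :=
  Module.Finite.equiv D.coord.symm

instance finite_cochains (n : ℕ) : Module.Finite K (D.cochains n) :=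
  have := D.module_finite
  inferInstance

/-- Hochschild cohomology is the cohomology of the complex of maps from the Koszul resolution. -/
def hochschildIso (n : ℕ) : HochschildCohomology K A n ≅
    (D.koszulComplex.linearYonedaObj K (regularBimodule K A)).homology n :=
  D.koszulResolution.isoExt n (regularBimodule K A)

lemma finrank_ker_linearYonedaObj (n : ℕ) :
    Module.finrank K (LinearMap.ker
      ((D.koszulComplex.linearYonedaObj K (regularBimodule K A)).d n (n + 1)).hom) =
    Module.finrank K (LinearMap.ker (D.coboundary n)) :=
  finrank_ker_eq_of_equiv _ _ (D.homEquiv n) (D.homEquiv (n + 1)) fun f => D.homEquiv_d_comp n f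

lemma finrank_range_linearYonedaObj (n : ℕ) :
    Module.finrank K (LinearMap.range
      ((D.koszulComplex.linearYonedaObj K (regularBimodule K A)).d n (n + 1)).hom) =
    Module.finrank K (LinearMap.range (D.coboundary n)) :=
  finrank_range_eq_of_equiv _ _ (D.homEquiv n) (D.homEquiv (n + 1)) fun f => D.homEquiv_d_comp n f

lemma finite_and_finrank_hochschildCohomology_zero :
    Module.Finite K (HochschildCohomology K A 0) ∧
      Module.finrank K (HochschildCohomology K A 0) =
        Module.finrank K (LinearMap.ker (D.coboundary 0)) := by
  let C := D.koszulComplex.linearYonedaObj K (regularBimodule K A)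
  have : Module.Finite K (C.sc' 0 0 1).X₂ := Module.Finite.equiv (D.homEquiv 0).symm
  obtain ⟨h₁, h₂⟩ := finite_homology_and_finrank_add_finrank_range (C.sc' 0 0 1)
  let E : HochschildCohomology K A 0 ≃ₗ[K] (C.sc' 0 0 1).homology :=
    (D.hochschildIso 0 ≪≫
      ShortComplex.homologyMapIso (C.isoSc' 0 0 1 (by simp) (by simp))).toLinearEquiv
  refine ⟨Module.Finite.equiv E.symm, ?_⟩
  -- the predecessor of `0` is `0` itself, and the differential from `0` to `0` is zero
  have h₀ : (C.sc' 0 0 1).f = 0 := C.shape 0 0 (by simp)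
  rw [h₀, ModuleCat.hom_zero, LinearMap.range_zero, finrank_bot, add_zero] at h₂
  exact E.finrank_eq.trans (h₂.trans (D.finrank_ker_linearYonedaObj 0))

lemma finite_and_finrank_hochschildCohomology_succ (n : ℕ) :
    Module.Finite K (HochschildCohomology K A (n + 1)) ∧
      Module.finrank K (HochschildCohomology K A (n + 1)) +
        Module.finrank K (LinearMap.range (D.coboundary n)) =
          Module.finrank K (LinearMap.ker (D.coboundary (n + 1))) := by
  let C := D.koszulComplex.linearYonedaObj K (regularBimodule K A)
  have : Module.Finite K (C.sc' n (n + 1) (n + 2)).X₂ :=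
    Module.Finite.equiv (D.homEquiv (n + 1)).symm
  obtain ⟨h₁, h₂⟩ := finite_homology_and_finrank_add_finrank_range (C.sc' n (n + 1) (n + 2))
  let E : HochschildCohomology K A (n + 1) ≃ₗ[K] (C.sc' n (n + 1) (n + 2)).homology :=
    (D.hochschildIso (n + 1) ≪≫
      ShortComplex.homologyMapIso (C.isoSc' n (n + 1) (n + 2) (by simp) (by simp))).toLinearEquiv
  refine ⟨Module.Finite.equiv E.symm, ?_⟩
  rw [← D.finrank_range_linearYonedaObj n, ← D.finrank_ker_linearYonedaObj (n + 1), E.finrank_eq]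
  exact h₂

end CircularPresentation

lemma finrank_ker_compLeft {K V W : Type*} [Field K] [AddCommGroup V] [Module K V]
    [AddCommGroup W] [Module K W] [Module.Finite K V] (f : V →ₗ[K] W) (k : ℕ) :
    Module.finrank K (LinearMap.ker (f.compLeft (Fin k))) =
      k * Module.finrank K (LinearMap.ker f) := by
  let E : LinearMap.ker (f.compLeft (Fin k)) ≃ₗ[K] (Fin k → LinearMap.ker f) :=
    { toFun := fun g j => ⟨g.1 j, congrFun g.2 j⟩
      map_add' := fun _ _ => rfl
      map_smul' := fun _ _ => rfl
      invFun := fun g => ⟨fun j => (g j).1, funext fun j => (g j).2⟩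
      left_inv := fun _ => rfl
      right_inv := fun _ => rfl }
  rw [E.finrank_eq, Module.finrank_pi_fintype]
  simp

/-! ### The twisted difference operator -/

lemma natCast_circularVertex_eq_iff {s : ℕ} (a b : ℕ) :
    ((a : CircularVertex s) = b) ↔ a ≡ b [MOD s] :=
  ZMod.natCast_eq_natCast_iff a b s

lemma card_circularVertex (s : ℕ) [NeZero s] : Fintype.card (CircularVertex s) = s :=
  ZMod.card s

/-- The operator `r ↦ (i ↦ r i - p * r (i - 1))` on functions on the vertices. -/
def twistedDifference (K : Type u) [Field K] (s : ℕ) (p : K) :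
    (CircularVertex s → K) →ₗ[K] (CircularVertex s → K) where
  toFun r i := r i - p * r (i - 1)
  map_add' r r' := by ext i; simp only [Pi.add_apply]; ring
  map_smul' c r := by ext i; simp only [Pi.smul_apply, smul_eq_mul, RingHom.id_apply]; ring

lemma twistedDifference_apply {K : Type u} [Field K] {s : ℕ} (p : K) (r : CircularVertex s → K)
    (i : CircularVertex s) : twistedDifference K s p r i = r i - p * r (i - 1) := rfl

/-- A function in the kernel is determined by its value at `0`, being multiplied by `p` at each
step; going once around the circle shows that it is zero unless `p ^ s = 1`. -/
lemma finrank_ker_twistedDifference {K : Type u} [Field K] {s : ℕ} (hs : 3 ≤ s) (p : K)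
    [Decidable (p ^ s = 1)] :
    Module.finrank K (LinearMap.ker (twistedDifference K s p)) = if p ^ s = 1 then 1 else 0 := by
  have hker : ∀ r ∈ LinearMap.ker (twistedDifference K s p), ∀ k : ℕ,
      r (k : CircularVertex s) = p ^ k * r 0 := by
    intro r hr k
    induction k with
    | zero => simp
    | succ k ih =>
      have := congrFun hr ((k + 1 : ℕ) : CircularVertex s)
      rw [twistedDifference_apply] at this
      rw [sub_eq_zero.1 this, Nat.cast_succ, add_sub_cancel_right, ih]
      ring
  have hs0 : ((s : ℕ) : CircularVertex s) = 0 := ZMod.natCast_self s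
  have : NeZero s := ⟨by omega⟩
  let val : CircularVertex s → ℕ := fun i => ZMod.val (n := s) i
  have hval : ∀ i, (val i : CircularVertex s) = i := fun i => ZMod.natCast_zmod_val (n := s) i
  split_ifs with hp
  · have hmod : ∀ {a b : ℕ}, a ≡ b [MOD s] → p ^ a = p ^ b := fun {a b} h => by
      have h' : a % s = b % s := h
      rw [← Nat.mod_add_div a s, ← Nat.mod_add_div b s, h', pow_add, pow_add, pow_mul, pow_mul, hp,
        one_pow, one_pow]
    -- the kernel is spanned by the powers of `p`, well defined on the circle as `p ^ s = 1`
    let v : CircularVertex s → K := fun i => p ^ val i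
    have hstep : ∀ i : CircularVertex s, v (i + 1) = p * v i := fun i => by
      rw [← pow_succ']
      refine hmod (natCast_circularVertex_eq_iff _ _ |>.1 ?_)
      rw [Nat.cast_succ, hval, hval]
    have hv : v ∈ LinearMap.ker (twistedDifference K s p) := by
      ext i
      have := hstep (i - 1)
      rw [sub_add_cancel] at this
      rw [twistedDifference_apply, this, sub_self]
      rfl
    refine finrank_eq_one (⟨v, hv⟩ : LinearMap.ker (twistedDifference K s p)) ?_ ?_
    · intro h
      have h0 := congrFun (congrArg Subtype.val h) 0
      have : v 0 = p ^ 0 := hmod (natCast_circularVertex_eq_iff _ _ |>.1 (by rw [hval]; simp))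
      exact one_ne_zero ((pow_zero p).symm.trans (this.symm.trans h0))
    · intro w
      refine ⟨w.1 0, ?_⟩
      ext i
      have := hker w.1 w.2 (val i)
      rw [hval] at this
      rw [this]
      exact mul_comm _ _
  · have : LinearMap.ker (twistedDifference K s p) = ⊥ := by
      rw [eq_bot_iff]
      intro r hr
      have h := hker r hr s
      rw [hs0] at h
      have h0 : r 0 = 0 := by
        by_contra hne
        exact hp (mul_right_cancel₀ hne (by rw [← h, one_mul]))
      rw [Submodule.mem_bot]
      ext i
      have := hker r hr (val i)
      rw [hval] at this
      rw [this, h0, mul_zero]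
      rfl
    rw [this, finrank_bot]

lemma twistedDifference_single {K : Type u} [Field K] {s : ℕ} (p : K) (i : CircularVertex s) :
    twistedDifference K s p (Pi.single i 1) = Pi.single i 1 - p • Pi.single (i + 1) 1 := by
  ext j
  simp [twistedDifference_apply, Pi.single_apply, sub_eq_iff_eq_add]

namespace CircularPresentation

open CircularRelations

variable {K : Type u} [Field K] {s : ℕ} [NeZero s] {A : Type u} [Ring A] [Algebra K A]
  (D : CircularPresentation K s A)

/-! ### Coboundaries in coordinates -/

lemma hom_ext {N : Type*} [AddCommGroup N] [Module K N] {f g : A →ₗ[K] N}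
    (h : ∀ l i, f (D.monomial l * D.e i) = g (D.monomial l * D.e i)) : f = g := by
  ext a
  rw [D.eq_sum a]
  simp [h]

lemma component_monomial_mul_e (n : ℕ) (l : Fin 4) (i : CircularVertex s) :
    D.component n (D.monomial l * D.e i) =
      if (n : CircularVertex s) = degree s l then D.monomial l * D.e i else 0 := by
  have h : ∀ k, D.e k * (D.monomial l * D.e i) * D.e (k + (n : CircularVertex s)) =
      D.monomial l * (if k + degree s l = i then
        if (n : CircularVertex s) = degree s l then D.e i else 0 else 0) := by
    intro k
    rw [← mul_assoc, e_mul_monomial, mul_assoc, mul_assoc, D.e_mul_e]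
    by_cases h₁ : k + degree s l = i
    · subst h₁
      simp [D.e_mul_e, eq_comm]
    · split_ifs with h₂
      · rw [D.e_mul_e_of_ne h₁]
      · simp
  simp only [component_apply, h]
  rw [Finset.sum_eq_single (i - degree s l)]
  · simp
  · intro k _ hk
    rw [if_neg (fun h' => hk (by rw [← h']; simp)), mul_zero]
  · simp

lemma coord_component (n : ℕ) (a : A) (l : Fin 4) :
    D.coord (D.component n a) l =
      if (n : CircularVertex s) = degree s l then D.coord a l else 0 := by
  have : LinearMap.proj l ∘ₗ D.coord.toLinearMap ∘ₗ D.component n =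
      (if (n : CircularVertex s) = degree s l then (1 : K) else 0) •
        (LinearMap.proj l ∘ₗ D.coord.toLinearMap) := by
    refine D.hom_ext fun k i => ?_
    simp only [LinearMap.comp_apply, LinearEquiv.coe_coe, component_monomial_mul_e,
      LinearMap.smul_apply, LinearMap.proj_apply]
    obtain rfl | hk := eq_or_ne l k
    · split_ifs <;> simp
    · split_ifs <;> simp [coord_monomial_mul_e, hk]
  refine (LinearMap.congr_fun this a).trans ?_
  split_ifs <;> simp

lemma mem_cochains_iff (n : ℕ) (c : Fin (n + 1) → A) :
    c ∈ D.cochains n ↔ ∀ j l, (n : CircularVertex s) ≠ degree s l → D.coord (c j) l = 0 := by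
  refine forall_congr' fun j => ?_
  rw [← D.coord.injective.eq_iff, funext_iff]
  refine forall_congr' fun l => ?_
  rw [coord_component]
  split_ifs with h <;> simp [h, eq_comm]

/-- A formula for one coordinate of a linear endomorphism can be checked on the basis `λ e_i`. -/
lemma coord_eq_of_basis (f : A →ₗ[K] A) (k : Fin 4)
    (g : (Fin 4 → CircularVertex s → K) →ₗ[K] (CircularVertex s → K))
    (h : ∀ l i, D.coord (f (D.monomial l * D.e i)) k = g (Pi.single l (Pi.single i 1))) (a : A) :
    D.coord (f a) k = g (D.coord a) := by
  have : LinearMap.proj k ∘ₗ D.coord.toLinearMap ∘ₗ f = g ∘ₗ D.coord.toLinearMap :=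
    D.hom_ext fun l i => by simpa [coord_monomial_mul_e] using h l i
  exact LinearMap.congr_fun this a

lemma coord_twistedCommutator_x (q : K) (a : A) :
    D.coord (twistedCommutator q D.x a) =
      ![0, twistedDifference K s (-q) (D.coord a 0), 0, twistedDifference K s q (D.coord a 2)] := by
  have h := D.coord_eq_of_basis (twistedCommutator q D.x)
  ext1 k
  fin_cases k
  · exact h 0 0 (fun l i => by
      rw [twistedCommutator_apply, x_mul_monomial_mul_e, monomial_mul_e_mul_x]
      fin_cases l <;> simp [coord_monomial_mul_e]) a
  · exact h 1 (twistedDifference K s (-q) ∘ₗ LinearMap.proj 0) (fun l i => by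
      rw [twistedCommutator_apply, x_mul_monomial_mul_e, monomial_mul_e_mul_x]
      fin_cases l <;> simp [coord_monomial_mul_e, twistedDifference_single]) a
  · exact h 2 0 (fun l i => by
      rw [twistedCommutator_apply, x_mul_monomial_mul_e, monomial_mul_e_mul_x]
      fin_cases l <;> simp [coord_monomial_mul_e]) a
  · exact h 3 (twistedDifference K s q ∘ₗ LinearMap.proj 2) (fun l i => by
      rw [twistedCommutator_apply, x_mul_monomial_mul_e, monomial_mul_e_mul_x]
      fin_cases l <;> simp [coord_monomial_mul_e, twistedDifference_single, sub_eq_add_neg]) a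

lemma coord_twistedCommutator_y (q : K) (a : A) :
    D.coord (twistedCommutator q D.y a) =
      ![0, 0, twistedDifference K s (-q) (D.coord a 0),
        -twistedDifference K s q (D.coord a 1)] := by
  have h := D.coord_eq_of_basis (twistedCommutator q D.y)
  ext1 k
  fin_cases k
  · exact h 0 0 (fun l i => by
      rw [twistedCommutator_apply, y_mul_monomial_mul_e, monomial_mul_e_mul_y]
      fin_cases l <;> simp [coord_monomial_mul_e]) a
  · exact h 1 0 (fun l i => by
      rw [twistedCommutator_apply, y_mul_monomial_mul_e, monomial_mul_e_mul_y]
      fin_cases l <;> simp [coord_monomial_mul_e]) a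
  · exact h 2 (twistedDifference K s (-q) ∘ₗ LinearMap.proj 0) (fun l i => by
      rw [twistedCommutator_apply, y_mul_monomial_mul_e, monomial_mul_e_mul_y]
      fin_cases l <;> simp [coord_monomial_mul_e, twistedDifference_single]) a
  · exact h 3 (-(twistedDifference K s q ∘ₗ LinearMap.proj 1)) (fun l i => by
      rw [twistedCommutator_apply, y_mul_monomial_mul_e, monomial_mul_e_mul_y]
      fin_cases l <;>
        simp [coord_monomial_mul_e, twistedDifference_single, sub_eq_add_neg, add_comm]) a

lemma snocZero_single_zero {M : Type u} [AddCommGroup M] [Module K M] (n : ℕ) (v : M) :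
    snocZero K (n + 1) (Pi.single 0 v) = Pi.single 0 v := by
  ext1 j
  cases j using Fin.lastCases with
  | last => simp
  | cast j =>
    rw [snocZero_castSucc]
    obtain rfl | hj := eq_or_ne j 0
    · simp
    · rw [Pi.single_eq_of_ne hj, Pi.single_eq_of_ne]
      simpa using hj

/-- The coordinates of a cochain at a given monomial. -/
def cochainCoord (n : ℕ) (l : Fin 4) :
    D.cochains n →ₗ[K] (Fin (n + 1) → CircularVertex s → K) where
  toFun c j := D.coord (c.1 j) l
  map_add' c c' := by ext; simp
  map_smul' r c := by ext; simp

lemma cochainCoord_apply (n : ℕ) (l : Fin 4) (c : D.cochains n) (j : Fin (n + 1)) :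
    D.cochainCoord n l c j = D.coord (c.1 j) l := rfl

/-- In a degree congruent to the length of a single monomial, a cochain is given by its coordinates
at that monomial. -/
def cochainEquiv (n : ℕ) (l : Fin 4) (h : ∀ k, (n : CircularVertex s) = degree s k ↔ k = l) :
    D.cochains n ≃ₗ[K] (Fin (n + 1) → CircularVertex s → K) :=
  LinearEquiv.ofBijective (D.cochainCoord n l) <| by
    constructor
    · rw [← LinearMap.ker_eq_bot, LinearMap.ker_eq_bot']
      intro c hc
      ext j
      refine D.coord.injective (funext fun k => ?_)
      obtain rfl | hk := eq_or_ne k l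
      · exact (congrFun hc j).trans (by simp)
      · exact ((D.mem_cochains_iff n _).1 c.2 j k (mt (h k).1 hk)).trans (by simp)
    · intro f
      refine ⟨⟨fun j => D.coord.symm (Pi.single l (f j)), (D.mem_cochains_iff n _).2 ?_⟩, ?_⟩
      · intro j k hk
        have : k ≠ l := fun h' => hk ((h k).2 h')
        simp [this]
      · ext j : 1
        simp [cochainCoord_apply]

/-- In a degree congruent to `1`, a cochain is given by its coordinates at `x` and `y`. -/
def cochainEquivProd (n : ℕ) (h : ∀ k, (n : CircularVertex s) = degree s k ↔ k = 1 ∨ k = 2) :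
    D.cochains n ≃ₗ[K]
      (Fin (n + 1) → CircularVertex s → K) × (Fin (n + 1) → CircularVertex s → K) :=
  LinearEquiv.ofBijective ((D.cochainCoord n 1).prod (D.cochainCoord n 2)) <| by
    constructor
    · rw [← LinearMap.ker_eq_bot, LinearMap.ker_eq_bot']
      intro c hc
      ext j
      refine D.coord.injective (funext fun k => ?_)
      by_cases hk : k = 1 ∨ k = 2
      · obtain rfl | rfl := hk
        · exact (congrFun (congrArg Prod.fst hc) j).trans (by simp)
        · exact (congrFun (congrArg Prod.snd hc) j).trans (by simp)
      · exact ((D.mem_cochains_iff n _).1 c.2 j k (mt (h k).1 hk)).trans (by simp)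
    · rintro ⟨f, g⟩
      refine ⟨⟨fun j => D.coord.symm (Pi.single 1 (f j) + Pi.single 2 (g j)),
        (D.mem_cochains_iff n _).2 ?_⟩, ?_⟩
      · intro j k hk
        obtain ⟨h₁, h₂⟩ := not_or.1 (mt (h k).2 hk)
        simp [h₁, h₂]
      · ext j : 2 <;> simp [cochainCoord_apply]

lemma cochains_eq_bot (n : ℕ) (h : ∀ k, (n : CircularVertex s) ≠ degree s k) :
    D.cochains n = ⊥ := by
  rw [eq_bot_iff]
  intro c hc
  rw [Submodule.mem_bot]
  ext j
  refine D.coord.injective (funext fun k => ?_)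
  exact ((D.mem_cochains_iff n _).1 hc j k (h k)).trans (by simp)

lemma finrank_cochains (n : ℕ) (l : Fin 4)
    (h : ∀ k, (n : CircularVertex s) = degree s k ↔ k = l) :
    Module.finrank K (D.cochains n) = (n + 1) * s := by
  rw [(D.cochainEquiv n l h).finrank_eq, Module.finrank_pi_fintype]
  simp [card_circularVertex]

lemma finrank_cochains_prod (n : ℕ)
    (h : ∀ k, (n : CircularVertex s) = degree s k ↔ k = 1 ∨ k = 2) :
    Module.finrank K (D.cochains n) = 2 * ((n + 1) * s) := by
  rw [(D.cochainEquivProd n h).finrank_eq, Module.finrank_prod, Module.finrank_pi_fintype]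
  simp [card_circularVertex, two_mul]

lemma eq_zero_of_cochainCoord {n : ℕ} {c : D.cochains n} (h : ∀ l, D.cochainCoord n l c = 0) :
    c = 0 := by
  ext j
  refine D.coord.injective (funext fun l => ?_)
  exact (congrFun (h l) j).trans (by simp)

lemma cochainCoord_eq_zero {n : ℕ} (c : D.cochains n) {l : Fin 4}
    (h : (n : CircularVertex s) ≠ degree s l) : D.cochainCoord n l c = 0 :=
  funext fun j => (D.mem_cochains_iff n _).1 c.2 j l h

lemma cochainCoord_coboundary (n : ℕ) (l : Fin 4) (c : D.cochains n) :
    D.cochainCoord (n + 1) l (D.coboundary n c) =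
      consZero K (n + 1)
        (fun j => D.coord (twistedCommutator ((-1 : K) ^ (n + 1)) D.x (c.1 j)) l) +
      snocZero K (n + 1)
        (fun j => D.coord (twistedCommutator ((-1 : K) ^ (n + 1)) D.y (c.1 j)) l) := by
  ext1 j
  rw [cochainCoord_apply, coboundary_val, Pi.add_apply, Pi.add_apply, map_add, Pi.add_apply]
  congr 1
  · cases j using Fin.cases <;> simp
  · cases j using Fin.lastCases <;> simp

lemma cochainCoord_zero_coboundary (n : ℕ) (c : D.cochains n) :
    D.cochainCoord (n + 1) 0 (D.coboundary n c) = 0 := by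
  simp only [cochainCoord_coboundary, coord_twistedCommutator_x, coord_twistedCommutator_y,
    Matrix.cons_val]
  exact (congrArg₂ (· + ·) (map_zero (consZero K (n + 1))) (map_zero (snocZero K (n + 1)))).trans
    (add_zero 0)

lemma cochainCoord_one_coboundary (n : ℕ) (c : D.cochains n) :
    D.cochainCoord (n + 1) 1 (D.coboundary n c) = consZero K (n + 1)
      ((twistedDifference K s ((-1) ^ n)).compLeft (Fin (n + 1)) (D.cochainCoord n 0 c)) := by
  have hq : -((-1 : K) ^ (n + 1)) = (-1) ^ n := by ring
  simp only [cochainCoord_coboundary, coord_twistedCommutator_x, coord_twistedCommutator_y,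
    Matrix.cons_val, hq]
  exact (congrArg (_ + ·) (map_zero (snocZero K (n + 1)))).trans (add_zero _)

lemma cochainCoord_two_coboundary (n : ℕ) (c : D.cochains n) :
    D.cochainCoord (n + 1) 2 (D.coboundary n c) = snocZero K (n + 1)
      ((twistedDifference K s ((-1) ^ n)).compLeft (Fin (n + 1)) (D.cochainCoord n 0 c)) := by
  have hq : -((-1 : K) ^ (n + 1)) = (-1) ^ n := by ring
  simp only [cochainCoord_coboundary, coord_twistedCommutator_x, coord_twistedCommutator_y,
    Matrix.cons_val, hq]
  exact (congrArg (· + _) (map_zero (consZero K (n + 1)))).trans (zero_add _)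

lemma cochainCoord_three_coboundary (n : ℕ) (c : D.cochains n) :
    D.cochainCoord (n + 1) 3 (D.coboundary n c) =
      (twistedDifference K s ((-1) ^ (n + 1))).compLeft (Fin (n + 2))
        (consZero K (n + 1) (D.cochainCoord n 2 c) -
          snocZero K (n + 1) (D.cochainCoord n 1 c)) := by
  simp only [cochainCoord_coboundary, coord_twistedCommutator_x, coord_twistedCommutator_y,
    Matrix.cons_val]
  ext1 j
  rw [LinearMap.compLeft_apply, Function.comp_apply, Pi.add_apply, Pi.sub_apply, map_sub,
    sub_eq_add_neg]
  congr 1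
  · cases j using Fin.cases with
    | zero => simp
    | succ j => simp only [consZero_succ, cochainCoord_apply]
  · cases j using Fin.lastCases with
    | last => simp
    | cast j => simp only [snocZero_castSucc, cochainCoord_apply]

/-! ### Dimension of the cohomology -/

lemma finrank_ker_coboundary_of_zero (n : ℕ)
    (h : ∀ k, (n : CircularVertex s) = degree s k ↔ k = 0) :
    Module.finrank K (LinearMap.ker (D.coboundary n)) =
      (n + 1) * Module.finrank K (LinearMap.ker (twistedDifference K s ((-1) ^ n))) := by
  rw [← finrank_ker_compLeft]
  refine LinearEquiv.finrank_eq (LinearEquiv.ofSubmodules (D.cochainEquiv n 0 h) _ _ ?_)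
  ext f
  obtain ⟨c, rfl⟩ := (D.cochainEquiv n 0 h).surjective f
  rw [Submodule.mem_map_equiv, LinearEquiv.symm_apply_apply, LinearMap.mem_ker, LinearMap.mem_ker]
  change _ ↔ (twistedDifference K s ((-1) ^ n)).compLeft (Fin (n + 1)) (D.cochainCoord n 0 c) = 0
  constructor
  · intro h0
    have h₁ := D.cochainCoord_one_coboundary n c
    rw [h0, map_zero] at h₁
    ext1 j
    exact (congrFun h₁ j.succ).symm
  · intro h0
    refine D.eq_zero_of_cochainCoord fun l => ?_
    fin_cases l
    · exact D.cochainCoord_zero_coboundary n c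
    · exact (D.cochainCoord_one_coboundary n c).trans (by rw [h0, map_zero])
    · exact (D.cochainCoord_two_coboundary n c).trans (by rw [h0, map_zero])
    · refine (D.cochainCoord_three_coboundary n c).trans ?_
      rw [D.cochainCoord_eq_zero c (l := 1) (mt (h 1).1 (by decide)),
        D.cochainCoord_eq_zero c (l := 2) (mt (h 2).1 (by decide))]
      simp only [map_zero, sub_zero]

lemma finrank_range_compLeft_twistedDifference (p : K) (k : ℕ) :
    Module.finrank K (LinearMap.range ((twistedDifference K s p).compLeft (Fin k))) +
      k * Module.finrank K (LinearMap.ker (twistedDifference K s p)) = k * s := by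
  rw [← finrank_ker_compLeft, LinearMap.finrank_range_add_finrank_ker, Module.finrank_pi_fintype]
  simp [card_circularVertex]

/-- In a degree congruent to `1`, the coboundary is the twisted difference operator applied to a
sequence that is an arbitrary difference of an extension by zero at the beginning and one at the
end; every sequence arises as such a difference. -/
lemma finrank_range_coboundary_of_one (n : ℕ)
    (h : ∀ k, (n : CircularVertex s) = degree s k ↔ k = 1 ∨ k = 2)
    (h' : ∀ k, ((n + 1 : ℕ) : CircularVertex s) = degree s k ↔ k = 3) :
    Module.finrank K (LinearMap.range (D.coboundary n)) +
      (n + 2) * Module.finrank K (LinearMap.ker (twistedDifference K s ((-1) ^ (n + 1)))) =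
        (n + 2) * s := by
  rw [← finrank_range_compLeft_twistedDifference (s := s) ((-1 : K) ^ (n + 1)) (n + 2)]
  congr 1
  refine LinearEquiv.finrank_eq (LinearEquiv.ofSubmodules (D.cochainEquiv (n + 1) 3 h') _ _ ?_)
  ext f
  constructor
  · rintro ⟨_, ⟨c, rfl⟩, rfl⟩
    exact ⟨_, (D.cochainCoord_three_coboundary n c).symm⟩
  · rintro ⟨g, rfl⟩
    -- `g` is its tail, shifted, minus the sequence concentrated at `0` with value `-g 0`
    obtain ⟨c, hc⟩ := (D.cochainEquivProd n h).surjective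
      (Pi.single 0 (-g 0), fun j => g j.succ)
    have h₁ : D.cochainCoord n 1 c = Pi.single 0 (-g 0) := congrArg Prod.fst hc
    have h₂ : D.cochainCoord n 2 c = fun j => g j.succ := congrArg Prod.snd hc
    refine ⟨D.coboundary n c, ⟨c, rfl⟩, (D.cochainCoord_three_coboundary n c).trans ?_⟩
    congr 1
    rw [h₁, h₂, snocZero_single_zero]
    ext1 j
    cases j using Fin.cases with
    | zero => simp
    | succ j => simp

lemma coboundary_eq_zero_of_succ (n : ℕ)
    (h : ∀ k, ((n + 1 : ℕ) : CircularVertex s) = degree s k → k = 0) : D.coboundary n = 0 := by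
  ext1 c
  refine D.eq_zero_of_cochainCoord fun l => ?_
  obtain rfl | hl := eq_or_ne l 0
  · exact D.cochainCoord_zero_coboundary n c
  · exact D.cochainCoord_eq_zero _ (mt (h l) hl)

lemma coboundary_eq_zero_of_three (n : ℕ)
    (h : ∀ k, (n : CircularVertex s) = degree s k → k = 3) : D.coboundary n = 0 := by
  ext1 c
  have h' : ∀ l, l ≠ 3 → D.cochainCoord n l c = 0 := fun l hl =>
    D.cochainCoord_eq_zero c (mt (h l) hl)
  refine D.eq_zero_of_cochainCoord fun l => ?_
  fin_cases l
  · exact D.cochainCoord_zero_coboundary n c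
  · exact (D.cochainCoord_one_coboundary n c).trans (by rw [h' 0 (by decide), map_zero, map_zero])
  · exact (D.cochainCoord_two_coboundary n c).trans (by rw [h' 0 (by decide), map_zero, map_zero])
  · refine (D.cochainCoord_three_coboundary n c).trans ?_
    rw [h' 1 (by decide), h' 2 (by decide)]
    simp only [map_zero, sub_zero]

omit [NeZero s] in
lemma natCast_eq_degree_iff {n : ℕ} (l : Fin 4) :
    (n : CircularVertex s) = degree s l ↔ n ≡ ![0, 1, 1, 2] l [MOD s] := by
  rw [← natCast_circularVertex_eq_iff]
  fin_cases l <;> simp [degree]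

omit [NeZero s] in
lemma neg_one_pow_pow_eq_one_iff (m : ℕ) :
    (((-1 : K) ^ (m * s)) ^ s = 1) ↔ (Even s ∨ Even m ∨ ringChar K = 2) := by
  by_cases h2 : ringChar K = 2
  · have : CharP K 2 := h2 ▸ ringChar.charP K
    simp [h2, CharTwo.neg_eq]
  · have h : (-1 : K) ≠ 1 := Ring.neg_one_ne_one_of_char_ne_two h2
    have hiff : ∀ k : ℕ, ((-1 : K) ^ k = 1) ↔ Even k := fun k => by
      obtain hk | hk := Nat.even_or_odd k
      · simp [hk]
      · simp [hk.neg_one_pow, h, Nat.not_even_iff_odd.2 hk]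
    rw [← pow_mul, hiff, Nat.even_mul, Nat.even_mul]
    tauto

theorem finite_and_finrank_hochschildCohomology (D : CircularPresentation K s A) (hs : 3 ≤ s)
    (m r : ℕ) (hr : r ≤ s - 1) :
    Module.Finite K (HochschildCohomology K A (m * s + r)) ∧
    Module.finrank K (HochschildCohomology K A (m * s + r)) =
      if Even s ∨ Even m ∨ ringChar K = 2 then
        if r = 0 then m * s + 1
        else if r = 1 then 2 * m * s + 4
        else if r = 2 then m * s + 3
        else 0
      else 0 := by
  classical
  let κ := Module.finrank K (LinearMap.ker (twistedDifference K s ((-1) ^ (m * s))))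
  have hκ : κ = if Even s ∨ Even m ∨ ringChar K = 2 then 1 else 0 := by
    simp only [κ, finrank_ker_twistedDifference hs, neg_one_pow_pow_eq_one_iff]
  have hsign : (-1 : K) ^ (m * s + 1 + 1) = (-1) ^ (m * s) := by ring
  have hdeg : ∀ t, ∀ l : Fin 4, ((m * s + t : ℕ) : CircularVertex s) = degree s l ↔
      t % s = ![0, 1, 1, 2] l := by
    intro t l
    rw [natCast_eq_degree_iff]
    have h : ![0, 1, 1, 2] l < s := by fin_cases l <;> simp <;> omega
    rw [Nat.ModEq, Nat.mul_add_mod', Nat.mod_eq_of_lt h]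
  have hdeg0 : ∀ l : Fin 4, ((m * s : ℕ) : CircularVertex s) = degree s l ↔ l = 0 := fun l => by
    rw [← add_zero (m * s), hdeg, Nat.zero_mod]
    fin_cases l <;> simp
  have hdeg1 : ∀ l : Fin 4, ((m * s + 1 : ℕ) : CircularVertex s) = degree s l ↔ l = 1 ∨ l = 2 :=
    fun l => by
      rw [hdeg, Nat.mod_eq_of_lt (by omega)]
      fin_cases l <;> simp
  have hdeg2 : ∀ l : Fin 4, ((m * s + 1 + 1 : ℕ) : CircularVertex s) = degree s l ↔ l = 3 :=
    fun l => by
      rw [add_assoc, hdeg, Nat.mod_eq_of_lt (by omega)]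
      fin_cases l <;> simp
  have hker₀ := D.finrank_ker_coboundary_of_zero (m * s) hdeg0
  have hrange₀ := LinearMap.finrank_range_add_finrank_ker (D.coboundary (m * s))
  rw [D.finrank_cochains _ 0 hdeg0, hker₀] at hrange₀
  have hrange₁ := D.finrank_range_coboundary_of_one (m * s + 1) hdeg1 hdeg2
  have hker₁ := LinearMap.finrank_range_add_finrank_ker (D.coboundary (m * s + 1))
  rw [D.finrank_cochains_prod _ hdeg1] at hker₁
  rw [hsign] at hrange₁
  change _ + (m * s + 1) * κ = _ at hrange₀
  change _ + (m * s + 1 + 2) * κ = _ at hrange₁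
  change _ = (m * s + 1) * κ at hker₀
  match r, hr with
  | 0, _ =>
    have hH : Module.Finite K (HochschildCohomology K A (m * s)) ∧
        Module.finrank K (HochschildCohomology K A (m * s)) =
          Module.finrank K (LinearMap.ker (D.coboundary (m * s))) := by
      obtain h0 | ⟨n, hn⟩ : m * s = 0 ∨ ∃ n, m * s = n + 1 := by
        cases m * s with
        | zero => exact Or.inl rfl
        | succ n => exact Or.inr ⟨n, rfl⟩
      · rw [h0]
        exact D.finite_and_finrank_hochschildCohomology_zero
      · rw [hn]
        have h := D.finite_and_finrank_hochschildCohomology_succ n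
        rwa [D.coboundary_eq_zero_of_succ n (fun k hk => (hdeg0 k).1 (hn ▸ hk)),
          LinearMap.range_zero, finrank_bot, add_zero] at h
    refine ⟨hH.1, hH.2.trans ?_⟩
    rw [hker₀, hκ]
    by_cases hP : Even s ∨ Even m ∨ ringChar K = 2
    · simp only [if_pos hP, if_true, mul_one]
    · simp only [if_neg hP, mul_zero]
  | 1, _ =>
    obtain ⟨h₁, h₂⟩ := D.finite_and_finrank_hochschildCohomology_succ (m * s)
    refine ⟨h₁, ?_⟩
    have h : Module.finrank K (HochschildCohomology K A (m * s + 1)) = (2 * m * s + 4) * κ := by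
      zify at h₂ hrange₀ hrange₁ hker₁ ⊢
      linear_combination h₂ + hker₁ - hrange₀ - hrange₁
    rw [h, hκ]
    by_cases hP : Even s ∨ Even m ∨ ringChar K = 2
    · simp only [if_pos hP, if_true, mul_one, one_ne_zero, if_false]
    · simp only [if_neg hP, mul_zero]
  | 2, _ =>
    obtain ⟨h₁, h₂⟩ := D.finite_and_finrank_hochschildCohomology_succ (m * s + 1)
    refine ⟨h₁, ?_⟩
    rw [D.coboundary_eq_zero_of_three (m * s + 1 + 1) (fun k hk => (hdeg2 k).1 hk),
      LinearMap.ker_zero,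
      finrank_top, D.finrank_cochains _ 3 hdeg2] at h₂
    have h : Module.finrank K (HochschildCohomology K A (m * s + 1 + 1)) = (m * s + 3) * κ := by
      zify at h₂ hrange₁ ⊢
      linear_combination h₂ - hrange₁
    refine Eq.trans h ?_
    rw [hκ]
    by_cases hP : Even s ∨ Even m ∨ ringChar K = 2
    · simp only [if_pos hP, if_true, mul_one, two_ne_zero, OfNat.ofNat_ne_one, if_false]
    · simp only [if_neg hP, mul_zero]
  | t + 3, ht =>
    have hbot : D.cochains (m * s + (t + 3)) = ⊥ := D.cochains_eq_bot _ fun k hk => by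
      rw [hdeg, Nat.mod_eq_of_lt (by omega)] at hk
      fin_cases k <;> simp at hk
    obtain ⟨h₁, h₂⟩ := D.finite_and_finrank_hochschildCohomology_succ (m * s + (t + 2))
    refine ⟨h₁, ?_⟩
    have h₃ := LinearMap.finrank_range_add_finrank_ker (D.coboundary (m * s + (t + 2) + 1))
    have h₄ : Module.finrank K (D.cochains (m * s + (t + 2) + 1)) = 0 :=
      (congrArg (fun V : Submodule K _ => Module.finrank K V) hbot).trans
        (finrank_bot K _)
    rw [h₄] at h₃
    change Module.finrank K (HochschildCohomology K A (m * s + (t + 2) + 1)) = _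
    have : Module.finrank K (HochschildCohomology K A (m * s + (t + 2) + 1)) = 0 := by omega
    rw [this]
    simp

end CircularPresentation

namespace CircularQuiver

open PathAlgebra

variable (K : Type u) [Field K] (s : ℕ)

/-! ### A basis of the circular quiver algebra -/

/-- The space of coordinates with respect to the basis `λ e_i`. -/
abbrev CoordSpace : Type u := Fin 4 → CircularVertex s → K

/-- Left multiplication by `x`, in coordinates. -/
def opX : Module.End K (CoordSpace K s) where
  toFun v := ![0, v 0, 0, v 2]
  map_add' v w := by ext l k; fin_cases l <;> simp
  map_smul' c v := by ext l k; fin_cases l <;> simp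

/-- Left multiplication by `y`, in coordinates. -/
def opY : Module.End K (CoordSpace K s) where
  toFun v := ![0, 0, v 0, -v 1]
  map_add' v w := by ext l k; fin_cases l <;> simp [add_comm]
  map_smul' c v := by ext l k; fin_cases l <;> simp

/-- Left multiplication by `e_i`, in coordinates: since `e_i λ = λ e_{i + |λ|}`, it keeps the
coordinate of `λ e_k` precisely if `k = i + |λ|`. -/
def opE (i : CircularVertex s) : Module.End K (CoordSpace K s) where
  toFun v l k := if k = i + CircularRelations.degree s l then v l k else 0
  map_add' v w := by ext l k; simp only [Pi.add_apply]; split_ifs <;> simp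
  map_smul' c v := by ext l k; simp

variable {K s}

lemma opX_apply (v : CoordSpace K s) : opX K s v = ![0, v 0, 0, v 2] := rfl
lemma opY_apply (v : CoordSpace K s) : opY K s v = ![0, 0, v 0, -v 1] := rfl
lemma opE_apply (i : CircularVertex s) (v : CoordSpace K s) (l : Fin 4) (k : CircularVertex s) :
    opE K s i v l k = if k = i + CircularRelations.degree s l then v l k else 0 := rfl

lemma opE_mul_opE (i j : CircularVertex s) :
    opE K s i * opE K s j = if i = j then opE K s i else 0 := by
  refine LinearMap.ext fun v => funext fun l => funext fun k => ?_
  rw [Module.End.mul_apply, opE_apply, opE_apply]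
  by_cases h : i = j
  · subst h
    rw [if_pos rfl, opE_apply]
    split_ifs <;> rfl
  · rw [if_neg h]
    split_ifs with h₁ h₂
    exacts [absurd (add_right_cancel (h₁.symm.trans h₂)) h, rfl, rfl]

lemma sum_opE [NeZero s] : ∑ i, opE K s i = 1 := by
  refine LinearMap.ext fun v => funext fun l => funext fun k => ?_
  simp only [LinearMap.sum_apply, Finset.sum_apply, opE_apply, Module.End.one_apply]
  rw [Finset.sum_eq_single (k - CircularRelations.degree s l)]
  · simp
  · intro i _ hi
    rw [if_neg fun h => hi (by rw [h, add_sub_cancel_right])]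
  · simp

lemma opE_mul_opX (i : CircularVertex s) : opE K s i * opX K s = opX K s * opE K s (i + 1) := by
  refine LinearMap.ext fun v => funext fun l => funext fun k => ?_
  rw [Module.End.mul_apply, Module.End.mul_apply, opE_apply, opX_apply, opX_apply]
  fin_cases l <;> simp [opE_apply, CircularRelations.degree, add_assoc, one_add_one_eq_two]

lemma opE_mul_opY (i : CircularVertex s) : opE K s i * opY K s = opY K s * opE K s (i + 1) := by
  refine LinearMap.ext fun v => funext fun l => funext fun k => ?_
  rw [Module.End.mul_apply, Module.End.mul_apply, opE_apply, opY_apply, opY_apply]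
  fin_cases l <;> simp [opE_apply, CircularRelations.degree, add_assoc, one_add_one_eq_two]
  split_ifs <;> simp

lemma opX_mul_opX : opX K s * opX K s = 0 := by
  refine LinearMap.ext fun v => funext fun l => ?_
  rw [Module.End.mul_apply, opX_apply, opX_apply]
  fin_cases l <;> simp

lemma opY_mul_opY : opY K s * opY K s = 0 := by
  refine LinearMap.ext fun v => funext fun l => ?_
  rw [Module.End.mul_apply, opY_apply, opY_apply]
  fin_cases l <;> simp

lemma opX_mul_opY_add : opX K s * opY K s + opY K s * opX K s = 0 := by
  refine LinearMap.ext fun v => funext fun l => ?_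
  rw [LinearMap.add_apply, Module.End.mul_apply, Module.End.mul_apply, opX_apply, opY_apply,
    opX_apply, opY_apply]
  fin_cases l <;> simp

variable (K) in
/-- The operator `opX` or `opY`, according to the kind of the arrow; it acts at all vertices. -/
def arrowOp : {i j : CircularVertex s} → (i ⟶ j) → Module.End K (CoordSpace K s)
  | _, _, .a _ => opX K s
  | _, _, .b _ => opY K s

variable (K) in
/-- The action of a path on coordinates. The idempotent at the terminus is inserted after each
arrow, as `arrowOp` does not see the vertices. -/
def pathOp {i : CircularVertex s} :
    {j : CircularVertex s} → Quiver.Path i j → Module.End K (CoordSpace K s)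
  | _, .nil => opE K s i
  | j, .cons p f => pathOp p * arrowOp K f * opE K s j

lemma opE_mul_pathOp {i j : CircularVertex s} (p : Quiver.Path i j) :
    opE K s i * pathOp K p = pathOp K p := by
  induction p with
  | nil => simp [pathOp, opE_mul_opE]
  | cons p f ih => rw [pathOp, ← mul_assoc, ← mul_assoc, ih]

lemma pathOp_mul_opE {i j : CircularVertex s} (p : Quiver.Path i j) :
    pathOp K p * opE K s j = pathOp K p := by
  cases p with
  | nil => simp [pathOp, opE_mul_opE]
  | cons p f => rw [pathOp, mul_assoc, opE_mul_opE, if_pos rfl]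

lemma pathOp_comp {i j k : CircularVertex s} (p : Quiver.Path i j) (q : Quiver.Path j k) :
    pathOp K (p.comp q) = pathOp K p * pathOp K q := by
  induction q with
  | nil => rw [Quiver.Path.comp_nil, pathOp, pathOp_mul_opE]
  | cons q f ih => rw [Quiver.Path.comp_cons, pathOp, ih, pathOp, mul_assoc, mul_assoc, mul_assoc]

lemma pathOp_mul_pathOp_of_ne {i j k l : CircularVertex s} (p : Quiver.Path i j)
    (q : Quiver.Path k l) (h : j ≠ k) : pathOp K p * pathOp K q = 0 := by
  rw [← pathOp_mul_opE, ← opE_mul_pathOp q, mul_assoc, ← mul_assoc (opE K s j), opE_mul_opE,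
    if_neg h, zero_mul, mul_zero]

variable (K s) in
/-- The linear extension of `pathOp` to the path algebra. -/
def repLinear : PathAlgebra K (CircularVertex s) →ₗ[K] Module.End K (CoordSpace K s) :=
  (basis K (CircularVertex s)).constr K fun p => pathOp K p.2.2

lemma repLinear_ofPath {i j : CircularVertex s} (p : Quiver.Path i j) :
    repLinear K s (ofPath K p) = pathOp K p := by
  simp [repLinear, ofPath]

lemma opE_single (i : CircularVertex s) :
    opE K s i (Pi.single 0 1) = Pi.single 0 (Pi.single i 1) := by
  ext l k
  rw [opE_apply]
  fin_cases l <;> simp [CircularRelations.degree, Pi.single_apply]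

variable [NeZero s]

lemma repLinear_mul (f g : PathAlgebra K (CircularVertex s)) :
    repLinear K s (f * g) = repLinear K s f * repLinear K s g := by
  induction f using PathAlgebra.induction_on with
  | zero => simp
  | add f f' hf hf' => simp [add_mul, hf, hf']
  | @smul c i j p =>
    induction g using PathAlgebra.induction_on with
    | zero => simp
    | add g g' hg hg' => rw [mul_add, map_add, hg, hg', map_add, mul_add]
    | @smul d k l q =>
      rw [smul_mul_smul_comm, map_smul, map_smul, map_smul, smul_mul_smul_comm]
      congr 1
      rw [repLinear_ofPath, repLinear_ofPath]
      obtain rfl | h := eq_or_ne j k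
      · rw [ofPath_mul_ofPath, repLinear_ofPath, pathOp_comp]
      · rw [ofPath_mul_ofPath_of_ne _ _ h, map_zero, pathOp_mul_pathOp_of_ne _ _ h]

variable (K s) in
/-- The representation of the path algebra on coordinates. -/
def rep : PathAlgebra K (CircularVertex s) →ₐ[K] Module.End K (CoordSpace K s) :=
  AlgHom.ofLinearMap (repLinear K s)
    (by simp only [PathAlgebra.one_def, map_sum, repLinear_ofPath, pathOp, sum_opE]) repLinear_mul

lemma rep_ofPath {i j : CircularVertex s} (p : Quiver.Path i j) :
    rep K s (ofPath K p) = pathOp K p := repLinear_ofPath p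

lemma rep_x : rep K s (x K s) = opX K s := by
  have h : ∀ i, rep K s (ofPath K (pathA s i)) = opE K s i * opX K s := fun i => by
    rw [rep_ofPath, pathA, Quiver.Hom.toPath, pathOp, pathOp, arrowOp, mul_assoc, ← opE_mul_opX,
      ← mul_assoc, opE_mul_opE, if_pos rfl]
  simp only [x, map_sum, h]
  rw [← Finset.sum_mul, sum_opE, one_mul]

lemma rep_y : rep K s (y K s) = opY K s := by
  have h : ∀ i, rep K s (ofPath K (pathB s i)) = opE K s i * opY K s := fun i => by
    rw [rep_ofPath, pathB, Quiver.Hom.toPath, pathOp, pathOp, arrowOp, mul_assoc, ← opE_mul_opY,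
      ← mul_assoc, opE_mul_opE, if_pos rfl]
  simp only [y, map_sum, h]
  rw [← Finset.sum_mul, sum_opE, one_mul]

lemma relationIdeal_le_ker : relationIdeal K s ≤ TwoSidedIdeal.ker (rep K s) := by
  rw [relationIdeal, TwoSidedIdeal.span_le]
  rintro a (rfl | rfl | rfl) <;> rw [SetLike.mem_coe, TwoSidedIdeal.mem_ker]
  · rw [map_pow, rep_x, pow_two, opX_mul_opX]
  · rw [map_add, map_mul, map_mul, rep_x, rep_y, opX_mul_opY_add]
  · rw [map_pow, rep_y, pow_two, opY_mul_opY]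

variable (K s) in
/-- The representation of the circular quiver algebra on coordinates. -/
def quotientRep : CircularAlgebra K s →ₐ[K] Module.End K (CoordSpace K s) :=
  (relationIdeal K s).ringCon.liftₐ (rep K s) fun _ _ h =>
    TwoSidedIdeal.ringCon_le_iff.1 relationIdeal_le_ker h

variable (K s) in
/-- The quotient map from the path algebra to the circular quiver algebra. -/
def quotientMap : PathAlgebra K (CircularVertex s) →ₐ[K] CircularAlgebra K s :=
  (relationIdeal K s).ringCon.mkₐ K

lemma quotientMap_eq_zero {a : PathAlgebra K (CircularVertex s)} (h : a ∈ relationIdeal K s) :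
    quotientMap K s a = 0 :=
  ((relationIdeal K s).ringCon.eq).2 h

lemma e_mul_x (i : CircularVertex s) :
    ofPath K (Quiver.Path.nil : Quiver.Path i i) * x K s = ofPath K (pathA s i) := by
  rw [x, Finset.mul_sum, Finset.sum_eq_single i]
  · rw [ofPath_mul_ofPath, Quiver.Path.nil_comp]
  · intro j _ hj
    rw [ofPath_mul_ofPath_of_ne _ _ hj.symm]
  · simp

lemma x_mul_e (i : CircularVertex s) :
    x K s * ofPath K (Quiver.Path.nil : Quiver.Path (i + 1) (i + 1)) = ofPath K (pathA s i) := by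
  rw [x, Finset.sum_mul, Finset.sum_eq_single i]
  · rw [ofPath_mul_ofPath, Quiver.Path.comp_nil]
  · intro j _ hj
    rw [ofPath_mul_ofPath_of_ne _ _ (by simpa using hj)]
  · simp

lemma e_mul_y (i : CircularVertex s) :
    ofPath K (Quiver.Path.nil : Quiver.Path i i) * y K s = ofPath K (pathB s i) := by
  rw [y, Finset.mul_sum, Finset.sum_eq_single i]
  · rw [ofPath_mul_ofPath, Quiver.Path.nil_comp]
  · intro j _ hj
    rw [ofPath_mul_ofPath_of_ne _ _ hj.symm]
  · simp

lemma y_mul_e (i : CircularVertex s) :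
    y K s * ofPath K (Quiver.Path.nil : Quiver.Path (i + 1) (i + 1)) = ofPath K (pathB s i) := by
  rw [y, Finset.sum_mul, Finset.sum_eq_single i]
  · rw [ofPath_mul_ofPath, Quiver.Path.comp_nil]
  · intro j _ hj
    rw [ofPath_mul_ofPath_of_ne _ _ (by simpa using hj)]
  · simp

lemma ofPath_toPath : {i j : CircularVertex s} → (f : i ⟶ j) →
    ofPath K f.toPath = ofPath K (Quiver.Path.nil : Quiver.Path i i) * x K s ∨
      ofPath K f.toPath = ofPath K (Quiver.Path.nil : Quiver.Path i i) * y K s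
  | i, _, .a _ => Or.inl (e_mul_x i).symm
  | i, _, .b _ => Or.inr (e_mul_y i).symm

variable (K s) in
/-- The trivial paths and the elements `x`, `y` of the circular quiver algebra, with their
relations. -/
def relations : CircularRelations s (CircularAlgebra K s) where
  e i := quotientMap K s (ofPath K (Quiver.Path.nil : Quiver.Path i i))
  x := quotientMap K s (x K s)
  y := quotientMap K s (y K s)
  e_mul_e i j := by
    rw [← map_mul]
    obtain rfl | h := eq_or_ne i j
    · rw [ofPath_mul_ofPath, Quiver.Path.nil_comp, if_pos rfl]
    · rw [ofPath_mul_ofPath_of_ne _ _ h, map_zero, if_neg h]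
  sum_e := by rw [← map_sum, ← PathAlgebra.one_def, map_one]
  e_mul_x i := by rw [← map_mul, ← map_mul, e_mul_x, x_mul_e]
  e_mul_y i := by rw [← map_mul, ← map_mul, e_mul_y, y_mul_e]
  x_mul_x := by
    rw [← map_mul, ← pow_two]
    exact quotientMap_eq_zero (TwoSidedIdeal.subset_span (by simp))
  y_mul_y := by
    rw [← map_mul, ← pow_two]
    exact quotientMap_eq_zero (TwoSidedIdeal.subset_span (by simp))
  y_mul_x := by
    rw [← map_mul, ← map_mul, eq_neg_iff_add_eq_zero, ← map_add, add_comm]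
    exact quotientMap_eq_zero (TwoSidedIdeal.subset_span (by simp))

variable (K s) in
/-- The linear combination of the elements `λ e_i` with given coefficients. -/
def monomialSum : CoordSpace K s →ₗ[K] CircularAlgebra K s where
  toFun r := ∑ l, ∑ i, r l i • ((relations K s).monomial l * (relations K s).e i)
  map_add' r r' := by simp only [Pi.add_apply, add_smul, Finset.sum_add_distrib]
  map_smul' c r := by
    simp only [Pi.smul_apply, smul_eq_mul, mul_smul, Finset.smul_sum, RingHom.id_apply]

lemma monomialSum_apply (r : CoordSpace K s) : monomialSum K s r =
    ∑ l, ∑ i, r l i • ((relations K s).monomial l * (relations K s).e i) := rfl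

lemma monomialSum_single (l : Fin 4) (i : CircularVertex s) :
    monomialSum K s (Pi.single l (Pi.single i 1)) =
      (relations K s).monomial l * (relations K s).e i := by
  rw [monomialSum_apply, Finset.sum_eq_single l]
  · rw [Finset.sum_eq_single i]
    · simp
    · intro j _ hj
      simp [hj]
    · simp
  · intro k _ hk
    simp [hk]
  · simp

lemma monomial_mul_e_mem (l : Fin 4) (i : CircularVertex s) :
    (relations K s).monomial l * (relations K s).e i ∈ LinearMap.range (monomialSum K s) :=
  ⟨_, monomialSum_single l i⟩

lemma mul_mem_range {w : CircularAlgebra K s}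
    (h : ∀ l i, w * ((relations K s).monomial l * (relations K s).e i) ∈
      LinearMap.range (monomialSum K s))
    {b : CircularAlgebra K s} (hb : b ∈ LinearMap.range (monomialSum K s)) :
    w * b ∈ LinearMap.range (monomialSum K s) := by
  obtain ⟨r, rfl⟩ := hb
  rw [monomialSum_apply, Finset.mul_sum]
  refine Submodule.sum_mem _ fun l _ => ?_
  rw [Finset.mul_sum]
  refine Submodule.sum_mem _ fun i _ => ?_
  rw [mul_smul_comm]
  exact Submodule.smul_mem _ _ (h l i)

lemma e_mul_mem_range (i : CircularVertex s) {b : CircularAlgebra K s}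
    (hb : b ∈ LinearMap.range (monomialSum K s)) :
    (relations K s).e i * b ∈ LinearMap.range (monomialSum K s) := by
  refine mul_mem_range (fun l k => ?_) hb
  rw [← mul_assoc, CircularRelations.e_mul_monomial, mul_assoc, CircularRelations.e_mul_e]
  split_ifs
  · exact monomial_mul_e_mem _ _
  · rw [mul_zero]; exact Submodule.zero_mem _

lemma x_mul_mem_range {b : CircularAlgebra K s}
    (hb : b ∈ LinearMap.range (monomialSum K s)) :
    (relations K s).x * b ∈ LinearMap.range (monomialSum K s) := by
  refine mul_mem_range (fun l k => ?_) hb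
  rw [CircularRelations.x_mul_monomial_mul_e]
  fin_cases l
  exacts [monomial_mul_e_mem _ _, Submodule.zero_mem _, monomial_mul_e_mem _ _,
    Submodule.zero_mem _]

lemma y_mul_mem_range {b : CircularAlgebra K s}
    (hb : b ∈ LinearMap.range (monomialSum K s)) :
    (relations K s).y * b ∈ LinearMap.range (monomialSum K s) := by
  refine mul_mem_range (fun l k => ?_) hb
  rw [CircularRelations.y_mul_monomial_mul_e]
  fin_cases l
  exacts [monomial_mul_e_mem _ _, Submodule.neg_mem _ (monomial_mul_e_mem _ _),
    Submodule.zero_mem _, Submodule.zero_mem _]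

lemma quotientMap_ofPath_mul_mem_range {i j : CircularVertex s} (p : Quiver.Path i j)
    {b : CircularAlgebra K s} (hb : b ∈ LinearMap.range (monomialSum K s)) :
    quotientMap K s (ofPath K p) * b ∈ LinearMap.range (monomialSum K s) := by
  induction p generalizing b with
  | nil => exact e_mul_mem_range i hb
  | cons p f ih =>
    have h : ofPath K (p.cons f) = ofPath K p * ofPath K f.toPath := by
      rw [ofPath_mul_ofPath]; rfl
    rw [h, map_mul, mul_assoc]
    refine ih ?_
    obtain hf | hf := ofPath_toPath (K := K) f <;> rw [hf, map_mul, mul_assoc]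
    · exact e_mul_mem_range _ (x_mul_mem_range hb)
    · exact e_mul_mem_range _ (y_mul_mem_range hb)

lemma monomialSum_surjective : Function.Surjective (monomialSum K s) := by
  intro a
  obtain ⟨a, rfl⟩ := (relationIdeal K s).ringCon.mk'_surjective a
  have h1 : (1 : CircularAlgebra K s) ∈ LinearMap.range (monomialSum K s) := by
    rw [← (relations K s).sum_e]
    refine Submodule.sum_mem _ fun i _ => ?_
    have := monomial_mul_e_mem (K := K) 0 i
    rwa [CircularRelations.monomial, Matrix.cons_val_zero, one_mul] at this
  change quotientMap K s a ∈ LinearMap.range (monomialSum K s)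
  induction a using PathAlgebra.induction_on with
  | zero => rw [map_zero]; exact Submodule.zero_mem _
  | add f g hf hg => rw [map_add]; exact Submodule.add_mem _ hf hg
  | smul c p =>
    rw [map_smul, ← mul_one (quotientMap K s (ofPath K p))]
    exact Submodule.smul_mem _ _ (quotientMap_ofPath_mul_mem_range p h1)

variable (K s) in
/-- The coordinates of an element, read off from its action on the coordinates of the unit. -/
def coordMap : CircularAlgebra K s →ₗ[K] CoordSpace K s :=
  LinearMap.applyₗ (Pi.single 0 1 : CoordSpace K s) ∘ₗ (quotientRep K s).toLinearMap

lemma coordMap_apply (a : CircularAlgebra K s) :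
    coordMap K s a = quotientRep K s a (Pi.single 0 1) := rfl

lemma coordMap_monomial_mul_e (l : Fin 4) (i : CircularVertex s) :
    coordMap K s ((relations K s).monomial l * (relations K s).e i) =
      Pi.single l (Pi.single i 1) := by
  have hx : quotientRep K s (relations K s).x = opX K s := rep_x
  have hy : quotientRep K s (relations K s).y = opY K s := rep_y
  have he : quotientRep K s ((relations K s).e i) = opE K s i := rep_ofPath _
  rw [coordMap_apply, map_mul, he, Module.End.mul_apply, opE_single]
  ext k : 1
  fin_cases l <;> fin_cases k <;>
    simp [CircularRelations.monomial, hx, hy, opX_apply, opY_apply]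

lemma coordMap_monomialSum (r : CoordSpace K s) : coordMap K s (monomialSum K s r) = r := by
  rw [monomialSum_apply]
  simp only [map_sum, map_smul, coordMap_monomial_mul_e]
  ext k i
  simp only [Finset.sum_apply, Pi.smul_apply, smul_eq_mul]
  rw [Finset.sum_eq_single k]
  · rw [Finset.sum_eq_single i]
    · simp
    · intro j _ hj
      simp [hj.symm]
    · simp
  · intro l _ hl
    simp [hl.symm]
  · simp

variable (K s) in
/-- The circular quiver algebra, with the basis `λ e_i`. -/
def presentation : CircularPresentation K s (CircularAlgebra K s) where
  toCircularRelations := relations K s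
  coord := (LinearEquiv.ofBijective (monomialSum K s)
    ⟨Function.LeftInverse.injective coordMap_monomialSum, monomialSum_surjective⟩).symm
  coord_symm_apply _ := rfl

end CircularQuiver

end

theorem theorem3p9 (K : Type u) [Field K] [IsAlgClosed K] (s : ℕ) [NeZero s] (hs : 3 ≤ s)
    (m r : ℕ) (hr : r ≤ s - 1) :
    Module.Finite K (HochschildCohomology K (CircularAlgebra K s) (m * s + r)) ∧
    Module.finrank K (HochschildCohomology K (CircularAlgebra K s) (m * s + r)) =
      if Even s ∨ Even m ∨ ringChar K = 2 then
        if r = 0 then m * s + 1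
        else if r = 1 then 2 * m * s + 4
        else if r = 2 then m * s + 3
        else 0
      else 0 :=
  (CircularQuiver.presentation K s).finite_and_finrank_hochschildCohomology hs m r hr
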